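/- **Theorem (Polygon convergence with desired size).** Let $n\ge 3$ robots with positions $\bm x_1,\dots,\bm x_n\in\mathbb R^3$ (indices modulo $n$) be given, $\bm x=(\bm x_1,\dots,\bm x_n)\in\mathbb R^{3n}$. For $\theta\in\mathbb R$ let $R_\theta$ be the counterclockwise rotation by $\theta$ around $\bm e_z=(0,0,1)^T$. Let $$\mathcal M_n=\{\bm x:\ \bm x_{i+1}-\bm x_i=R_{2\pi/n}(\bm x_{i+2}-\bm x_{i+1})\ (1\le i\le n-2),\ \ \bm e_z^T(\bm x_n-\bm x_{n-1})=\bm e_z^T(\bm x_1-\bm x_n)\}$$ be the subspace of regular polygons with normal $\bm e_z$ and, for $\rho>0$, $\mathcal M_{n\rho}=\{\bm x\in\mathcal M_n:\ \|\bm x_{i+1}-\bm x_i\|=\rho\ \forall i\}$. Put $\bar p(\bm x)=\frac1n\sum_{i=1}^n\bigl(1-\|\bm x_{i+1}-\bm x_i\|/\rho\bigr)$. Let $0<N<n-1$, gains $k_1,\dots,k_N>0$, $\alpha_{s_0}>0$, $\tau>0$, and let $f_s:\mathbb R\to\mathbb R$ be continuous and odd with $pf_s(p)>0$ for $p\ne0$,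 $|f_s|\le1$, and $f_s$ differentiable at $0$ with $f_s'(0)>a$ for some $a>0$. Consider the hybrid dynamics $$\dot{\bm x}_i(t)=\sum_{m=1}^N k_m\bigl[R_{\alpha_m}(\bm x_{i+m}(t)-\bm x_i(t))+R_{\alpha_m}^T(\bm x_{i-m}(t)-\bm x_i(t))\bigr],\qquad \alpha_m=\tfrac{m\pi}{n}+\alpha_{s_0}f_s\bigl(\bar p(\bm x((k-1)\tau))\bigr),$$ for $t\in[k\tau,(k+1)\tau)$, $k=0,1,2,\dots$, with $\bm x$ continuous on $[0,\infty)$; for $k=0$ the configuration $\bm x(-\tau)$ is an arbitrary initial datum. For $1\le i\le n$, $k\in\{-1,0,1\}$ (with $j^2=-1$) let $\phi_{ik}=\bigl(e^{2\pi(i-1+k)j/n}-1\bigr)\bigl(e^{2\pi(i-1)j/n}-1\bigr)$ and let $$\lambda_{ik}^{(m)}=\frac{2}{e^{2\pi(2(i-1)+k)j/n}}\Bigl[\cos(k\alpha_m)-\cos\bigl(k\alpha_m+\tfrac{2\pi m(i-1)}{n}\bigr)\Bigr]\phi_{ik}^2,$$ which is a real number. Assume $$\inf_{\alpha_m\in[m\pi/n-\alpha_{s_0},\,m\pi/n+\alpha_{s_0}],\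 1\le m\le N}\ \ \min_{\substack{1\le i\le n,\ k\in\{-1,0,1\}\\ \phi_{ik}\neq0}}\ \sum_{m=1}^N k_m\lambda_{ik}^{(m)}>0 .$$ Let $C=2\Gamma$ with $$\Gamma=\frac{\sqrt{2(1-\cos(2\pi/n))}}{\sin(\pi/n)}\sum_{m=1}^Nk_m\ \ (n\text{ even}),\qquad \Gamma=\frac{\sqrt{2(1-\cos(2\pi/n))}}{2\sin(\pi/(2n))}\sum_{m=1}^Nk_m\ \ (n\text{ odd}),$$ let $T>0$ be such that $\tfrac12T|p|\le|\sin(\alpha_{s_0}f_s(p))|\le T|p|$ for all $|p|<1$, and suppose $\tau<\min\{1/C,\ 1/(8CT)\}$. Then, for every trajectory such that the orthogonal projection of $\bm x(0)$ onto $\mathcal M_n$ is not degenerate (its $n$ points do not all coincide), $\bm x(t)$ converges to $\mathcal M_{n\rho}$, i.e. $\operatorname{dist}(\bm x(t),\mathcal M_{n\rho})\to0$ as $t\to\infty$. -/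

import Mathlib

open scoped BigOperators

noncomputable section

/-- Positions of `n` robots in space: `ℝ^{3n}` with its Euclidean norm. The robots are labelled
cyclically, robot `i` being the class of `i` modulo `n` (so robot `n` is the class `0`). -/
abbrev Config (n : ℕ) : Type := PiLp 2 (fun _ : ZMod n => EuclideanSpace ℝ (Fin 3))

/-- The matrix of the counterclockwise rotation by `θ` around `e_z = (0,0,1)`. -/
def rotMatrix (θ : ℝ) : Matrix (Fin 3) (Fin 3) ℝ :=
  !![Real.cos θ, -Real.sin θ, 0; Real.sin θ, Real.cos θ, 0; 0, 0, 1]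

/-- The rotation `R_θ` around `e_z` acting on `ℝ³`. -/
def rot (θ : ℝ) : EuclideanSpace ℝ (Fin 3) →ₗ[ℝ] EuclideanSpace ℝ (Fin 3) :=
  Matrix.toEuclideanLin (rotMatrix θ)

/-- The transpose `R_θᵀ` acting on `ℝ³`. -/
def rotT (θ : ℝ) : EuclideanSpace ℝ (Fin 3) →ₗ[ℝ] EuclideanSpace ℝ (Fin 3) :=
  Matrix.toEuclideanLin (rotMatrix θ).transpose

/-- The formation subspace `M_n` of regular polygons with normal `e_z`, cut out by the `n - 2`
rotational constraints and the in-plane constraint. -/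
def formationSubspace (n : ℕ) : Submodule ℝ (Config n) where
  carrier := {x | (∀ i : ℕ, 1 ≤ i → i + 2 ≤ n →
      x ((i : ZMod n) + 1) - x (i : ZMod n) =
        rot (2 * Real.pi / n) (x ((i : ZMod n) + 2) - x ((i : ZMod n) + 1))) ∧
      x (n : ZMod n) 2 - x ((n : ZMod n) - 1) 2 = x 1 2 - x (n : ZMod n) 2}
  zero_mem' := by
    refine ⟨fun i _ _ => ?_, ?_⟩ <;> simp
  add_mem' := by
    rintro x y ⟨hx, hx'⟩ ⟨hy, hy'⟩
    refine ⟨fun i h1 h2 => ?_, ?_⟩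
    · simp only [PiLp.add_apply]
      rw [add_sub_add_comm, hx i h1 h2, hy i h1 h2, add_sub_add_comm, map_add]
    · simp only [PiLp.add_apply]
      linarith
  smul_mem' := by
    rintro c x ⟨hx, hx'⟩
    refine ⟨fun i h1 h2 => ?_, ?_⟩
    · simp only [PiLp.smul_apply]
      rw [← smul_sub, hx i h1 h2, ← smul_sub, map_smul]
    · simp only [PiLp.smul_apply, smul_eq_mul]
      linear_combination c * hx'

/-- `M_{nρ}`: the regular polygons in `M_n` all of whose sides have length `ρ`. -/
def formationOfSize (n : ℕ) (ρ : ℝ) : Set (Config n) :=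
  {x | x ∈ formationSubspace n ∧ ∀ i : ZMod n, ‖x (i + 1) - x i‖ = ρ}

/-- The normalized inter-robot distance error `p_i(x)`. -/
def distError {n : ℕ} (ρ : ℝ) (x : Config n) (i : ZMod n) : ℝ :=
  1 - ‖x (i + 1) - x i‖ / ρ

/-- The average inter-robot distance error `p̄(x)`. -/
def avgDistError {n : ℕ} [NeZero n] (ρ : ℝ) (x : Config n) : ℝ :=
  (∑ i : ZMod n, distError ρ x i) / n

/-- The symmetric cyclic control law for robot `i` with look-ahead horizon `N`, gains `κ m` and
rotation angles `mπ/n + s`, evaluated at the configuration `x`. -/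
def cyclicControl (n N : ℕ) (κ : ℕ → ℝ) (s : ℝ) (x : Config n) (i : ZMod n) :
    EuclideanSpace ℝ (Fin 3) :=
  ∑ m ∈ Finset.Icc 1 N,
    κ m • (rot (m * Real.pi / n + s) (x (i + (m : ZMod n)) - x i) +
      rotT (m * Real.pi / n + s) (x (i - (m : ZMod n)) - x i))

/-- `x` is a trajectory of `ẋ_i = u_i` under the hybrid controller: every robot moves continuously
on `[0, ∞)` and on `[kτ, (k+1)τ)`, for every `k = 0, 1, 2, …`, solves the differential equation
whose rotation angles `mπ/n + α₀ f(p̄(x((k-1)τ)))` use the error measured at the previous sampling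
instant. For `k = 0` the configuration `x(-τ)` is a free initial datum. -/
structure IsHybridTrajectory (n N : ℕ) [NeZero n] (κ : ℕ → ℝ) (ρ α₀ : ℝ) (f : ℝ → ℝ) (τ : ℝ)
    (x : ℝ → Config n) : Prop where
  continuousOn : ∀ i : ZMod n, ContinuousOn (fun t => x t i) (Set.Ici 0)
  hasDeriv : ∀ k : ℕ, ∀ t ∈ Set.Ico ((k : ℝ) * τ) (((k : ℝ) + 1) * τ), ∀ i : ZMod n,
    HasDerivWithinAt (fun t => x t i)
      (cyclicControl n N κ (α₀ * f (avgDistError ρ (x (((k : ℝ) - 1) * τ)))) (x t) i)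
      (Set.Ici t) t

/-- The admissible functions `f_s`. -/
structure IsSizeFunction (f : ℝ → ℝ) : Prop where
  continuous : Continuous f
  odd : Function.Odd f
  mul_pos : ∀ p : ℝ, p ≠ 0 → 0 < p * f p
  abs_le_one : ∀ p : ℝ, |f p| ≤ 1
  differentiableAt_zero : DifferentiableAt ℝ f 0
  deriv_zero : ∃ a : ℝ, 0 < a ∧ a < deriv f 0

/-- The factor `(e^{2π(i-1+k)j/n} - 1)(e^{2π(i-1)j/n} - 1)`. -/
def modeFactor (n i : ℕ) (k : ℤ) : ℂ :=
  (Complex.exp (2 * Real.pi * ((i : ℂ) - 1 + k) * Complex.I / n) - 1) *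
    (Complex.exp (2 * Real.pi * ((i : ℂ) - 1) * Complex.I / n) - 1)

/-- The eigenvalue `λ_{ik}^{(m)}` for the rotation angle `α = α_m`. -/
def modeEigenvalue (n m i : ℕ) (k : ℤ) (α : ℝ) : ℂ :=
  2 / Complex.exp (2 * Real.pi * (2 * ((i : ℂ) - 1) + k) * Complex.I / n) *
    ((Real.cos (k * α) - Real.cos (k * α + 2 * Real.pi * m * ((i : ℝ) - 1) / n) : ℝ) : ℂ) *
    modeFactor n i k ^ 2

/-- The number `λ_{ik}^{(m)}` is real. -/
theorem modeEigenvalue_im (n m i : ℕ) (k : ℤ) (α : ℝ) : (modeEigenvalue n m i k α).im = 0 := by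
  have key : ∀ a : ℝ, (Complex.exp (a * Complex.I) - 1) ^ 2 / Complex.exp (a * Complex.I) =
      ((2 * Real.cos a - 2 : ℝ) : ℂ) := by
    intro a
    have h := Complex.exp_ne_zero (a * Complex.I)
    have h2 : ((2 * Real.cos a : ℝ) : ℂ) =
        Complex.exp (a * Complex.I) + (Complex.exp (a * Complex.I))⁻¹ := by
      push_cast
      rw [Complex.two_cos, ← Complex.exp_neg]
      ring_nf
    rw [Complex.ofReal_sub, h2]
    field_simp
    push_cast
    ring
  have e1 : (2 * Real.pi * ((i : ℂ) - 1 + k) * Complex.I / n) =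
      ((2 * Real.pi * ((i : ℝ) - 1 + k) / n : ℝ) : ℂ) * Complex.I := by
    push_cast; ring
  have e2 : (2 * Real.pi * ((i : ℂ) - 1) * Complex.I / n) =
      ((2 * Real.pi * ((i : ℝ) - 1) / n : ℝ) : ℂ) * Complex.I := by
    push_cast; ring
  have e3 : (2 * Real.pi * (2 * ((i : ℂ) - 1) + k) * Complex.I / n) =
      ((2 * Real.pi * ((i : ℝ) - 1 + k) / n : ℝ) : ℂ) * Complex.I +
      ((2 * Real.pi * ((i : ℝ) - 1) / n : ℝ) : ℂ) * Complex.I := by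
    push_cast; ring
  have h1 := key (2 * Real.pi * ((i : ℝ) - 1 + k) / n)
  have h2 := key (2 * Real.pi * ((i : ℝ) - 1) / n)
  have : modeEigenvalue n m i k α =
      ((2 * (Real.cos (k * α) - Real.cos (k * α + 2 * Real.pi * m * ((i : ℝ) - 1) / n)) *
        ((2 * Real.cos (2 * Real.pi * ((i : ℝ) - 1 + k) / n) - 2) *
        (2 * Real.cos (2 * Real.pi * ((i : ℝ) - 1) / n) - 2)) : ℝ) : ℂ) := by
    rw [modeEigenvalue, modeFactor, e1, e2, e3, Complex.exp_add, Complex.ofReal_mul,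
      Complex.ofReal_mul (2 * Real.cos (2 * Real.pi * ((i : ℝ) - 1 + k) / n) - 2), ← h1, ← h2,
      Complex.ofReal_mul]
    have := Complex.exp_ne_zero (((2 * Real.pi * ((i : ℝ) - 1 + k) / n : ℝ) : ℂ) * Complex.I)
    have := Complex.exp_ne_zero (((2 * Real.pi * ((i : ℝ) - 1) / n : ℝ) : ℂ) * Complex.I)
    rw [Complex.ofReal_ofNat]
    field_simp
  rw [this, Complex.ofReal_im]

/-- The uniform eigenvalue condition: the infimum over all angles
`α_m ∈ [mπ/n - α₀, mπ/n + α₀]` of the minimum over the modes `(i, k)` of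
`∑_{m=1}^N k_m λ_{ik}^{(m)}` is positive. The modes with vanishing factor are exactly the
directions of `M_n` itself; there `λ_{ik}^{(m)} = 0` identically, and they do not take part in
the minimum. -/
def EigenvalueCondition (n N : ℕ) (κ : ℕ → ℝ) (α₀ : ℝ) : Prop :=
  ∃ c : ℝ, 0 < c ∧ ∀ α : ℕ → ℝ,
    (∀ m ∈ Finset.Icc 1 N, α m ∈ Set.Icc (m * Real.pi / n - α₀) (m * Real.pi / n + α₀)) →
    ∀ i ∈ Finset.Icc 1 n, ∀ k ∈ ({-1, 0, 1} : Finset ℤ), modeFactor n i k ≠ 0 →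
      c ≤ ∑ m ∈ Finset.Icc 1 N, κ m * (modeEigenvalue n m i k (α m)).re

/-- The constant `Γ`. -/
def gammaConst (n N : ℕ) (κ : ℕ → ℝ) : ℝ :=
  if Even n then
    √(2 * (1 - Real.cos (2 * Real.pi / n))) / Real.sin (Real.pi / n) * ∑ m ∈ Finset.Icc 1 N, κ m
  else
    √(2 * (1 - Real.cos (2 * Real.pi / n))) / (2 * Real.sin (Real.pi / (2 * n))) *
      ∑ m ∈ Finset.Icc 1 N, κ m

/-- The constant `C = 2Γ`. -/
def rateConst (n N : ℕ) (κ : ℕ → ℝ) : ℝ := 2 * gammaConst n N κ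

end

/-!
# Convergence of the cyclic pursuit formation to a regular polygon of the desired size

Identify the horizontal plane with `ℂ`. On the planar coordinates and on the heights the control law
is a circulant operator, so the discrete Fourier transform on `ℤ/n` diagonalizes it for every value
of the rotation angles simultaneously (`dft_coupling`), with real eigenvalues. The subspace `M_n`
consists of the planar modes `0` and `-1` and the height mode `0`. On every other mode the eigenvalue
condition bounds the rate by a negative constant, uniformly in the angles, so these modes decay
although the angles switch at every sampling instant: `x(t)` approaches its part in `M_n`
(`IsHybridTrajectory.tendsto_sub_nearestPolygon`).

It remains to follow the mode `-1`, the amplitude of the polygon, which is nonzero at the start by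
nondegeneracy (`dft_planar_ne_zero`). When all angles are shifted by `s` its rate is a positive
multiple `g` of `sin s` (`modeRate_neg_one`). Hence the logarithm `y k` of side length over `ρ` at
time `kτ` satisfies `y (k + 2) = y (k + 1) + H (p k)`, where `H p = g τ sin (α₀ f p)` and `p k`, the
average distance error measured at time `kτ`, differs from `1 - exp (y k)` by a quantity that tends to
zero. The eigenvalue condition forces `α₀ < π / 2`, so `H p` has the sign of `p`, and the bound on `τ`
gives `|H p| ≤ |p| / 8` for `|p| ≤ 1`.

Such a recursion converges to zero (`tendsto_zero_of_delayed_recursion`). The step towards zero is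
taken with a delay of one, so after `y` crosses zero it can overshoot for two steps only. As `p ≤ 1`,
the overshoot above is at most a fixed small number whatever the starting point, even though nothing
is known about the size of the steps from very large polygons. Then `p` stays in `[-1, 1]`, the
overshoot below is small as well, and from there on the linear bound halves every asymptotic bound on
`|y|`.
-/

open Filter Topology ZMod

/-! ### A scalar recursion with delayed feedback -/

/-- If `y` stayed above `δ`, it would decrease to a limit `l ≥ δ`, and its increments `H (p k)` would
tend to both `0` and `H (φ l) < 0`. -/
theorem frequently_le_of_delayed_recursion {φ H : ℝ → ℝ} (hφ : Continuous φ)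
    (hφneg : ∀ y, 0 < y → φ y < 0) (hH : Continuous H) (hHneg : ∀ p, p < 0 → H p < 0)
    {y p : ℕ → ℝ} (hp : Tendsto (fun k => p k - φ (y k)) atTop (𝓝 0))
    (hrec : ∀ k, y (k + 2) = y (k + 1) + H (p k)) {δ : ℝ} (hδ : 0 < δ)
    (hsign : ∀ᶠ k in atTop, δ < y k → H (p k) ≤ 0) :
    ∃ᶠ k in atTop, y k ≤ δ := by
  intro hcon
  obtain ⟨K, hK⟩ := eventually_atTop.1 (hcon.and hsign)
  have hgt : ∀ k, K ≤ k → δ < y k := fun k hk => not_le.1 (hK k hk).1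
  have hanti : Antitone fun k => y (k + (K + 1)) := by
    refine antitone_nat_of_succ_le fun k => ?_
    have h1 := hrec (k + K)
    have h2 := (hK (k + K) (by omega)).2 (hgt _ (by omega))
    have e1 : k + 1 + (K + 1) = k + K + 2 := by omega
    have e2 : k + (K + 1) = k + K + 1 := by omega
    rw [e1, e2]
    linarith
  have hbdd : BddBelow (Set.range fun k => y (k + (K + 1))) :=
    ⟨δ, by rintro _ ⟨k, rfl⟩; exact (hgt _ (by omega)).le⟩
  have hlim := (tendsto_add_atTop_iff_nat (K + 1)).1 (tendsto_atTop_ciInf hanti hbdd)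
  set l := ⨅ k, y (k + (K + 1))
  have hl : δ ≤ l := ge_of_tendsto hlim (eventually_atTop.2 ⟨K, fun k hk => (hgt k hk).le⟩)
  have hplim : Tendsto p atTop (𝓝 (φ l)) := by
    simpa using hp.add ((hφ.tendsto l).comp hlim)
  have hHlim := (hH.tendsto (φ l)).comp hplim
  have hzero : Tendsto (H ∘ p) atTop (𝓝 (l - l)) := by
    refine (((tendsto_add_atTop_iff_nat 2).2 hlim).sub
      ((tendsto_add_atTop_iff_nat 1).2 hlim)).congr fun k => ?_
    simp [hrec k]
  have := tendsto_nhds_unique hHlim hzero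
  have := hHneg _ (hφneg l (hδ.trans_le hl))
  linarith

/-- Eventually a step can increase `y` only if the value one step earlier was at most `δ`. Hence after a visit
below `δ` the sequence rises for at most two further steps, and the peak reached in these two steps
bounds everything that follows. No bound on the size of the downward steps is needed. -/
theorem eventually_le_of_delayed_recursion {φ H : ℝ → ℝ} (hφ : Continuous φ) (hφanti : Antitone φ)
    (hφneg : ∀ y, 0 < y → φ y < 0) (hH : Continuous H) (hHneg : ∀ p, p < 0 → H p < 0)
    {y p : ℕ → ℝ} (hp : Tendsto (fun k => p k - φ (y k)) atTop (𝓝 0))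
    (hrec : ∀ k, y (k + 2) = y (k + 1) + H (p k)) {δ B : ℝ} (hδ : 0 < δ)
    (hB : ∀ᶠ k in atTop, y (k + 1) ≤ δ →
      y (k + 1) + max (H (p k)) 0 + max (H (p (k + 1))) 0 ≤ B) :
    ∀ᶠ k in atTop, y k ≤ B := by
  have hsign : ∀ᶠ k in atTop, δ < y k → H (p k) ≤ 0 := by
    have : 0 < -φ δ := by linarith [hφneg δ hδ]
    filter_upwards [hp.eventually_lt_const this] with k hk hy
    have := hφanti hy.le
    exact (hHneg _ (by linarith)).le
  obtain ⟨K, hK⟩ := eventually_atTop.1 (hsign.and hB)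
  obtain ⟨j, hj, hyj⟩ := frequently_atTop.1
    (frequently_le_of_delayed_recursion hφ hφneg hH hHneg hp hrec hδ hsign) (K + 1)
  obtain ⟨i, rfl⟩ : ∃ i, j = i + 1 := ⟨j - 1, by omega⟩
  have hinv : ∀ k, i ≤ k → y (k + 1) ≤ B ∧ y (k + 2) ≤ B := by
    intro k hk
    induction k, hk using Nat.le_induction with
    | base =>
      have h := (hK i (by omega)).2 hyj
      have h0 := le_max_right (H (p i)) 0
      have h1 := le_max_left (H (p i)) 0
      have h2 := le_max_right (H (p (i + 1))) 0
      exact ⟨by linarith, by rw [hrec]; linarith⟩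
    | succ k hk ih =>
      refine ⟨ih.2, ?_⟩
      have hr := hrec (k + 1)
      have hr' := hrec k
      by_cases hy : y (k + 1) ≤ δ
      · have h := (hK k (by omega)).2 hy
        have h1 := le_max_left (H (p k)) 0
        have h2 := le_max_left (H (p (k + 1))) 0
        linarith
      · have h := (hK (k + 1) (by omega)).1 (not_le.1 hy)
        linarith
  exact eventually_atTop.2 ⟨i + 1, fun k hk => by
    obtain ⟨l, rfl⟩ : ∃ l, k = l + 1 := ⟨k - 1, by omega⟩
    exact (hinv l (by omega)).1⟩

/-- The mirror image of `eventually_le_of_delayed_recursion`, under `y ↦ -y` and `p ↦ -p`. -/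
theorem eventually_ge_of_delayed_recursion {φ H : ℝ → ℝ} (hφ : Continuous φ) (hφanti : Antitone φ)
    (hφpos : ∀ y, y < 0 → 0 < φ y) (hH : Continuous H) (hHpos : ∀ p, 0 < p → 0 < H p)
    {y p : ℕ → ℝ} (hp : Tendsto (fun k => p k - φ (y k)) atTop (𝓝 0))
    (hrec : ∀ k, y (k + 2) = y (k + 1) + H (p k)) {δ B : ℝ} (hδ : 0 < δ)
    (hB : ∀ᶠ k in atTop, -δ ≤ y (k + 1) →
      -B ≤ y (k + 1) - max (-H (p k)) 0 - max (-H (p (k + 1))) 0) :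
    ∀ᶠ k in atTop, -B ≤ y k := by
  have := eventually_le_of_delayed_recursion (φ := fun y => -φ (-y)) (H := fun p => -H (-p))
    (y := fun k => -y k) (p := fun k => -p k) (δ := δ) (B := B) (by fun_prop)
    (fun a b hab => neg_le_neg (hφanti (neg_le_neg hab)))
    (fun y hy => by simpa using hφpos (-y) (by simpa using hy)) (by fun_prop)
    (fun p hp => by simpa using hHpos (-p) (by simpa using hp))
    (by simpa [neg_add_eq_sub, sub_eq_add_neg, add_comm] using hp.neg)
    (fun k => by simp only [neg_neg]; rw [hrec]; ring) hδ ?_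
  · exact this.mono fun k hk => by linarith
  · filter_upwards [hB] with k hk hy
    simp only [neg_neg]
    linarith [hk (by linarith)]

/-- Global convergence of the delayed recursion `y (k + 2) = y (k + 1) + H (p k)` in which `p k` is an
asymptotically exact measurement of `1 - exp (y k)`. -/
theorem tendsto_zero_of_delayed_recursion {H : ℝ → ℝ} (hH : Continuous H)
    (hHpos : ∀ p, 0 < p → 0 < H p) (hHneg : ∀ p, p < 0 → H p < 0)
    (hlin : ∀ p, |p| ≤ 1 → |H p| ≤ |p| / 8) {y p : ℕ → ℝ} (hp1 : ∀ k, p k ≤ 1)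
    (hp : Tendsto (fun k => p k - (1 - Real.exp (y k))) atTop (𝓝 0))
    (hrec : ∀ k, y (k + 2) = y (k + 1) + H (p k)) : Tendsto y atTop (𝓝 0) := by
  have hφ : Continuous fun y : ℝ => 1 - Real.exp y := by fun_prop
  have hφanti : Antitone fun y : ℝ => 1 - Real.exp y := fun a b hab =>
    sub_le_sub_left (Real.exp_le_exp.2 hab) _
  have hφneg : ∀ y : ℝ, 0 < y → 1 - Real.exp y < 0 := fun y hy => by
    linarith [Real.one_lt_exp_iff.2 hy]
  have hφpos : ∀ y : ℝ, y < 0 → 0 < 1 - Real.exp y := fun y hy => by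
    linarith [Real.exp_lt_one_iff.2 hy]
  have hHle : ∀ p, p ≤ 1 → max (H p) 0 ≤ 1 / 8 := fun p hp => by
    refine max_le ?_ (by norm_num)
    rcases lt_or_ge p 0 with h | h
    · linarith [hHneg p h]
    · have := hlin p (by rwa [abs_of_nonneg h])
      rw [abs_of_nonneg h] at this
      linarith [le_abs_self (H p)]
  have hsucc {P : ℕ → Prop} (h : ∀ᶠ k in atTop, P k) : ∀ᶠ k in atTop, P (k + 1) :=
    (tendsto_add_atTop_nat 1).eventually h
  -- Since `p ≤ 1`, each of the two upward steps after a visit below `1 / 8` is at most `1 / 8`.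
  have hup : ∀ᶠ k in atTop, y k ≤ 3 / 8 :=
    eventually_le_of_delayed_recursion hφ hφanti hφneg hH hHneg hp hrec (δ := 1 / 8) (by norm_num)
      (Eventually.of_forall fun k hk => by linarith [hHle _ (hp1 k), hHle _ (hp1 (k + 1))])
  -- `exp (3 / 8) ≤ 7 / 4`, so that `p` has entered the range where `H` is linearly bounded.
  have hpabs : ∀ᶠ k in atTop, |p k| ≤ 1 := by
    filter_upwards [hup, hp.eventually_const_lt (show (-(1 / 16) : ℝ) < 0 by norm_num)] with k h1 h2
    refine abs_le.2 ⟨?_, hp1 k⟩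
    have h3 := Real.abs_exp_sub_one_le (x := 3 / 8) (by rw [abs_of_pos] <;> norm_num)
    have h4 := Real.exp_le_exp.2 h1
    rw [abs_of_pos (show (0 : ℝ) < 3 / 8 by norm_num)] at h3
    linarith [le_abs_self (Real.exp (3 / 8) - 1)]
  have hHabs : ∀ᶠ k in atTop, |H (p k)| ≤ 1 / 8 := hpabs.mono fun k hk => by
    linarith [hlin _ hk]
  have hlow : ∀ᶠ k in atTop, -(3 / 8) ≤ y k := by
    refine eventually_ge_of_delayed_recursion hφ hφanti hφpos hH hHpos hp hrec (δ := 1 / 8)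
      (by norm_num) ?_
    filter_upwards [hHabs, hsucc hHabs] with k h1 h2 h3
    have h4 : max (-H (p k)) 0 ≤ 1 / 8 := max_le ((neg_le_abs _).trans h1) (by norm_num)
    have h5 : max (-H (p (k + 1))) 0 ≤ 1 / 8 := max_le ((neg_le_abs _).trans h2) (by norm_num)
    linarith
  -- A bound `b` halves. Below `δ = b / 16` the value itself plus its own effect `|y| / 4 + b / 16`
  -- is at most `3 b / 16`, and the effect of the value before it is at most `5 b / 16`.
  have hstep : ∀ b : ℝ, 0 < b → b ≤ 3 / 8 → (∀ᶠ k in atTop, |y k| ≤ b) →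
      ∀ᶠ k in atTop, |y k| ≤ b / 2 := by
    intro b hb hb1 hyb
    have hpabs0 := hp.abs
    rw [abs_zero] at hpabs0
    have hHy : ∀ᶠ k in atTop, |H (p k)| ≤ |y k| / 4 + b / 16 := by
      filter_upwards [hpabs, hyb, hpabs0.eventually_lt_const
        (show (0 : ℝ) < b / 2 by positivity)] with k h1 h2 h3
      have h4 := Real.abs_exp_sub_one_le (x := y k) (by linarith)
      have h5 : |p k| ≤ |p k - (1 - Real.exp (y k))| + |Real.exp (y k) - 1| := by
        have := abs_add_le (p k - (1 - Real.exp (y k))) (-(Real.exp (y k) - 1))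
        rwa [abs_neg, show p k - (1 - Real.exp (y k)) + -(Real.exp (y k) - 1) = p k by ring]
          at this
      linarith [hlin _ h1]
    have hHb : ∀ᶠ k in atTop, |H (p k)| ≤ 5 / 16 * b := by
      filter_upwards [hHy, hyb] with k h1 h2
      linarith
    have hU : ∀ᶠ k in atTop, y k ≤ b / 2 := by
      refine eventually_le_of_delayed_recursion hφ hφanti hφneg hH hHneg hp hrec (δ := b / 16)
        (by positivity) ?_
      filter_upwards [hHb, hsucc hHy] with k h1 h2 h3
      have h4 : max (H (p k)) 0 ≤ 5 / 16 * b := max_le ((le_abs_self _).trans h1) (by positivity)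
      have h5 : max (H (p (k + 1))) 0 ≤ |y (k + 1)| / 4 + b / 16 :=
        max_le ((le_abs_self _).trans h2) (by positivity)
      rcases abs_cases (y (k + 1)) with h | h <;> linarith
    have hL : ∀ᶠ k in atTop, -(b / 2) ≤ y k := by
      refine eventually_ge_of_delayed_recursion hφ hφanti hφpos hH hHpos hp hrec (δ := b / 16)
        (by positivity) ?_
      filter_upwards [hHb, hsucc hHy] with k h1 h2 h3
      have h4 : max (-H (p k)) 0 ≤ 5 / 16 * b := max_le ((neg_le_abs _).trans h1) (by positivity)
      have h5 : max (-H (p (k + 1))) 0 ≤ |y (k + 1)| / 4 + b / 16 :=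
        max_le ((neg_le_abs _).trans h2) (by positivity)
      rcases abs_cases (y (k + 1)) with h | h <;> linarith
    filter_upwards [hU, hL] with k h1 h2
    exact abs_le.2 ⟨h2, h1⟩
  have hpow : ∀ l : ℕ, ∀ᶠ k in atTop, |y k| ≤ 3 / 8 * (1 / 2) ^ l := by
    intro l
    induction l with
    | zero =>
      filter_upwards [hup, hlow] with k h1 h2
      simpa using abs_le.2 ⟨h2, h1⟩
    | succ l ih =>
      have h1 : ((1 : ℝ) / 2) ^ l ≤ 1 := pow_le_one₀ (by norm_num) (by norm_num)
      refine (hstep _ (by positivity) (by linarith) ih).mono fun k hk => hk.trans_eq ?_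
      rw [pow_succ]
      ring
  rw [Metric.tendsto_nhds]
  intro ε hε
  obtain ⟨l, hl⟩ := exists_pow_lt_of_lt_one hε (show (1 / 2 : ℝ) < 1 by norm_num)
  filter_upwards [hpow l] with k hk
  rw [Real.dist_eq, sub_zero]
  have : (0 : ℝ) < (1 / 2) ^ l := by positivity
  linarith

/-! ### Fourier modes of the control law -/

/-- The projection of `ℝ³` to the `xy`-plane, the plane being identified with `ℂ`. -/
noncomputable def planarPart : EuclideanSpace ℝ (Fin 3) →ₗ[ℝ] ℂ where
  toFun v := (v 0 : ℂ) + (v 1 : ℂ) * Complex.I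
  map_add' v w := by simp; ring
  map_smul' c v := by simp; ring

theorem planarPart_apply (v : EuclideanSpace ℝ (Fin 3)) :
    planarPart v = (v 0 : ℂ) + (v 1 : ℂ) * Complex.I := rfl

theorem planarPart_rot (θ : ℝ) (v : EuclideanSpace ℝ (Fin 3)) :
    planarPart (rot θ v) = Complex.exp (θ * Complex.I) * planarPart v := by
  rw [Complex.exp_mul_I, ← Complex.ofReal_cos, ← Complex.ofReal_sin]
  apply Complex.ext <;>
  simp [rot, rotMatrix, planarPart_apply, Matrix.toLpLin_apply, dotProduct,
    Fin.sum_univ_three] <;> ring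

theorem planarPart_rotT (θ : ℝ) (v : EuclideanSpace ℝ (Fin 3)) :
    planarPart (rotT θ v) = Complex.exp (-(θ * Complex.I)) * planarPart v := by
  rw [← neg_mul, ← Complex.ofReal_neg, Complex.exp_mul_I, ← Complex.ofReal_cos,
    ← Complex.ofReal_sin]
  apply Complex.ext <;>
  simp [rotT, rotMatrix, planarPart_apply, Matrix.toLpLin_apply, Matrix.mulVec, dotProduct,
    Fin.sum_univ_three]
  ring

theorem rot_apply_two (θ : ℝ) (v : EuclideanSpace ℝ (Fin 3)) : rot θ v 2 = v 2 := by
  simp [rot, rotMatrix, Matrix.toLpLin_apply, dotProduct, Fin.sum_univ_three]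

theorem rotT_apply_two (θ : ℝ) (v : EuclideanSpace ℝ (Fin 3)) : rotT θ v 2 = v 2 := by
  simp [rotT, rotMatrix, Matrix.toLpLin_apply, Matrix.mulVec, dotProduct,
    Fin.sum_univ_three]

/-- The planar parts of the positions, as a signal on `ℤ/n`. -/
noncomputable def planar {n : ℕ} (x : Config n) (i : ZMod n) : ℂ := planarPart (x i)

/-- The `z`-coordinates of the positions, as a signal on `ℤ/n`; complex-valued so that the discrete
Fourier transform applies to it. -/
def height {n : ℕ} (x : Config n) (i : ZMod n) : ℂ := (x i 2 : ℂ)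

/-- The control law on a complex signal, with arbitrary rotation angles `α m`. The planar part of the
closed loop has this form with the actual angles, the heights with all angles zero. -/
noncomputable def coupling (n N : ℕ) (κ α : ℕ → ℝ) (y : ZMod n → ℂ) (i : ZMod n) : ℂ :=
  ∑ m ∈ Finset.Icc 1 N, (κ m : ℂ) *
    (Complex.exp (α m * Complex.I) * (y (i + m) - y i) +
      Complex.exp (-(α m * Complex.I)) * (y (i - m) - y i))

/-- The eigenvalue of `coupling` on the `q`-th Fourier mode of `ℤ/n`. -/
noncomputable def modeRate (n N : ℕ) (κ α : ℕ → ℝ) (q : ZMod n) : ℝ :=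
  ∑ m ∈ Finset.Icc 1 N,
    κ m * (2 * Real.cos (α m + 2 * Real.pi * m * q.val / n) - 2 * Real.cos (α m))

theorem dft_comp_add {n : ℕ} [NeZero n] (y : ZMod n → ℂ) (m q : ZMod n) :
    𝓕 (fun i => y (i + m)) q = stdAddChar (m * q) * 𝓕 y q := by
  simp only [dft_apply, Finset.mul_sum, smul_eq_mul]
  refine Fintype.sum_equiv (Equiv.addRight m) _ _ fun i => ?_
  simp only [Equiv.coe_addRight]
  rw [← mul_assoc, ← AddChar.map_add_eq_mul]
  congr 2
  ring

theorem stdAddChar_natCast_mul {n : ℕ} [NeZero n] (m : ℕ) (q : ZMod n) :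
    stdAddChar ((m : ZMod n) * q) =
      Complex.exp ((2 * Real.pi * m * q.val / n : ℝ) * Complex.I) := by
  have h : (m : ZMod n) * q = (((m : ℤ) * (q.val : ℤ) : ℤ) : ZMod n) := by
    push_cast
    rw [ZMod.natCast_zmod_val]
  rw [h, stdAddChar_coe]
  congr 1
  push_cast
  ring

theorem dft_coupling {n : ℕ} [NeZero n] (N : ℕ) (κ α : ℕ → ℝ) (y : ZMod n → ℂ) (q : ZMod n) :
    𝓕 (coupling n N κ α y) q = modeRate n N κ α q * 𝓕 y q := by
  have hdecomp : coupling n N κ α y = ∑ m ∈ Finset.Icc 1 N, ((κ m : ℂ) •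
      (Complex.exp (α m * Complex.I) • ((fun i => y (i + (m : ZMod n))) - y) +
        Complex.exp (-(α m * Complex.I)) • ((fun i => y (i + -(m : ZMod n))) - y))) := by
    ext i
    simp [coupling, Finset.sum_apply, ← sub_eq_add_neg, mul_add]
  rw [hdecomp, map_sum, Finset.sum_apply, modeRate, Complex.ofReal_sum, Finset.sum_mul]
  refine Finset.sum_congr rfl fun m _ => ?_
  simp only [_root_.map_smul, map_add, map_sub, Pi.smul_apply, Pi.add_apply, Pi.sub_apply, smul_eq_mul,
    dft_comp_add]
  rw [neg_mul, AddChar.map_neg_eq_inv, stdAddChar_natCast_mul, ← Complex.exp_neg]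
  set θ : ℝ := 2 * Real.pi * m * q.val / n
  have h1 := Complex.two_cos ((α m + θ : ℝ) : ℂ)
  have h2 := Complex.two_cos (α m : ℂ)
  have h3 : Complex.exp (((α m + θ : ℝ) : ℂ) * Complex.I) =
      Complex.exp (α m * Complex.I) * Complex.exp (θ * Complex.I) := by
    rw [← Complex.exp_add]; push_cast; ring_nf
  have h4 : Complex.exp (-((α m + θ : ℝ) : ℂ) * Complex.I) =
      Complex.exp (-(α m * Complex.I)) * Complex.exp (-(θ * Complex.I)) := by
    rw [← Complex.exp_add]; push_cast; ring_nf
  rw [h3, h4] at h1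
  rw [neg_mul] at h2
  push_cast at h1 ⊢
  rw [h1, h2]
  ring

theorem mem_Icc_floor_mul {t τ : ℝ} (ht : 0 ≤ t) (hτ : 0 < τ) :
    t ∈ Set.Icc ((⌊t / τ⌋₊ : ℝ) * τ) (((⌊t / τ⌋₊ : ℝ) + 1) * τ) :=
  ⟨(le_div_iff₀ hτ).1 (Nat.floor_le (div_nonneg ht hτ.le)),
    ((div_lt_iff₀ hτ).1 (Nat.lt_floor_add_one (t / τ))).le⟩

/-- `Y` is continuous on `[0, ∞)` and follows `ẏ = coupling (A k) y` on each `[kτ, (k+1)τ)`, the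
derivative being taken from the right. -/
structure IsPiecewiseCoupled (n N : ℕ) (κ : ℕ → ℝ) (τ : ℝ) (A : ℕ → ℕ → ℝ)
    (Y : ℝ → ZMod n → ℂ) : Prop where
  continuousOn : ∀ i, ContinuousOn (fun t => Y t i) (Set.Ici 0)
  hasDeriv : ∀ k : ℕ, ∀ t ∈ Set.Ico ((k : ℝ) * τ) (((k : ℝ) + 1) * τ), ∀ i,
    HasDerivWithinAt (fun t => Y t i) (coupling n N κ (A k) (Y t) i) (Set.Ici t) t

namespace IsPiecewiseCoupled

variable {n N : ℕ} [NeZero n] {κ : ℕ → ℝ} {τ : ℝ} {A : ℕ → ℕ → ℝ} {Y : ℝ → ZMod n → ℂ}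

theorem dft_eq (hY : IsPiecewiseCoupled n N κ τ A Y) (hτ : 0 < τ) (q : ZMod n) (k : ℕ) {t : ℝ}
    (ht : t ∈ Set.Icc ((k : ℝ) * τ) (((k : ℝ) + 1) * τ)) :
    𝓕 (Y t) q = Complex.exp ((modeRate n N κ (A k) q * (t - k * τ) : ℝ)) *
      𝓕 (Y (k * τ)) q := by
  set r := modeRate n N κ (A k) q with hr
  have hsub : Set.Icc ((k : ℝ) * τ) (((k : ℝ) + 1) * τ) ⊆ Set.Ici 0 := fun s hs =>
    le_trans (by positivity) hs.1
  have hexp : ∀ s : ℝ, HasDerivAt (fun s : ℝ => Complex.exp ((-(r * (s - k * τ)) : ℝ)))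
      (Complex.exp ((-(r * (s - k * τ)) : ℝ)) * (-r : ℝ)) s := fun s => by
    refine HasDerivAt.cexp (HasDerivAt.ofReal_comp ?_)
    simpa using (((hasDerivAt_id s).sub_const (k * τ)).const_mul r).fun_neg
  have key := constant_of_has_deriv_right_zero
    (f := fun s : ℝ => Complex.exp ((-(r * (s - k * τ)) : ℝ)) * 𝓕 (Y s) q)
    (a := k * τ) (b := (k + 1) * τ) ?_ ?_ t ht
  · simp only [sub_self, mul_zero, neg_zero, Complex.ofReal_zero, Complex.exp_zero, one_mul] at key
    rw [← key, ← mul_assoc, ← Complex.exp_add, ← Complex.ofReal_add, add_neg_cancel,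
      Complex.ofReal_zero, Complex.exp_zero, one_mul]
  · refine ContinuousOn.mul (by fun_prop) ?_
    simp only [dft_apply]
    exact continuousOn_finsetSum _ fun i _ =>
      ((hY.continuousOn i).mono hsub).fun_const_smul _
  · intro s hs
    have hd : HasDerivWithinAt (fun s => 𝓕 (Y s) q) (r * 𝓕 (Y s) q) (Set.Ici s) s := by
      rw [hr, ← dft_coupling]
      simp only [dft_apply]
      exact HasDerivWithinAt.fun_sum fun i _ => (hY.hasDeriv k s hs i).fun_const_smul _
    refine ((hexp s).hasDerivWithinAt.mul hd).congr_deriv ?_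
    push_cast
    ring

/-- The angles may switch at every sampling instant; a rate bound uniform in `k` still makes the mode
decay exponentially. -/
theorem tendsto_dft_zero (hY : IsPiecewiseCoupled n N κ τ A Y) (hτ : 0 < τ) (q : ZMod n) {c : ℝ}
    (hc : 0 < c) (hA : ∀ k, modeRate n N κ (A k) q ≤ -c) :
    Tendsto (fun t => 𝓕 (Y t) q) atTop (𝓝 0) := by
  have hstep : ∀ k : ℕ, ∀ t ∈ Set.Icc ((k : ℝ) * τ) (((k : ℝ) + 1) * τ),
      ‖𝓕 (Y t) q‖ ≤ Real.exp (-c * (t - k * τ)) * ‖𝓕 (Y (k * τ)) q‖ := by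
    intro k t ht
    rw [hY.dft_eq hτ q k ht, norm_mul, Complex.norm_exp, Complex.ofReal_re]
    have := hA k
    have := ht.1
    gcongr
  have hgrid : ∀ k : ℕ, ‖𝓕 (Y (k * τ)) q‖ ≤ Real.exp (-c * (k * τ)) * ‖𝓕 (Y 0) q‖ := by
    intro k
    induction k with
    | zero => simp
    | succ k ih =>
      have h := hstep k ((k + 1 : ℝ) * τ) ⟨by nlinarith, le_rfl⟩
      push_cast
      refine h.trans ((mul_le_mul_of_nonneg_left ih (Real.exp_pos _).le).trans_eq ?_)
      rw [← mul_assoc, ← Real.exp_add]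
      ring_nf
  refine squeeze_zero_norm' (a := fun t => Real.exp (-c * t) * ‖𝓕 (Y 0) q‖) ?_ ?_
  · filter_upwards [eventually_ge_atTop 0] with t ht
    refine (hstep ⌊t / τ⌋₊ t (mem_Icc_floor_mul ht hτ)).trans
      ((mul_le_mul_of_nonneg_left (hgrid _) (Real.exp_pos _).le).trans_eq ?_)
    rw [← mul_assoc, ← Real.exp_add]
    ring_nf
  · have : Tendsto (fun t : ℝ => -c * t) atTop atBot :=
      tendsto_id.const_mul_atTop_of_neg (by linarith)
    simpa using (Real.tendsto_exp_atBot.comp this).mul_const ‖𝓕 (Y 0) q‖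

end IsPiecewiseCoupled

theorem planarPart_cyclicControl {n N : ℕ} (κ : ℕ → ℝ) (s : ℝ) (x : Config n) (i : ZMod n) :
    planarPart (cyclicControl n N κ s x i) =
      coupling n N κ (fun m => m * Real.pi / n + s) (planar x) i := by
  simp [cyclicControl, coupling, planar, planarPart_rot, planarPart_rotT, mul_add, mul_sub]

theorem height_cyclicControl {n N : ℕ} (κ : ℕ → ℝ) (s : ℝ) (x : Config n) (i : ZMod n) :
    (cyclicControl n N κ s x i 2 : ℂ) = coupling n N κ (fun _ => 0) (height x) i := by
  simp [cyclicControl, coupling, height, rot_apply_two, rotT_apply_two, mul_add]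

/-! ### Decay rates from the eigenvalue condition -/

/-- The eigenvalue in terms of real cosines, by `(e^{ja} - 1)² / e^{ja} = 2 cos a - 2`. With
`q = i - 1` it is `-2 (cos (kα + 2πmq/n) - cos (kα))` times a factor in `[0, 16]` that does not
depend on `m`. -/
theorem modeEigenvalue_eq (n m i : ℕ) (k : ℤ) (α : ℝ) : modeEigenvalue n m i k α =
    ((2 * (Real.cos (k * α) - Real.cos (k * α + 2 * Real.pi * m * ((i : ℝ) - 1) / n)) *
      ((2 * Real.cos (2 * Real.pi * ((i : ℝ) - 1 + k) / n) - 2) *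
      (2 * Real.cos (2 * Real.pi * ((i : ℝ) - 1) / n) - 2)) : ℝ) : ℂ) := by
  have key : ∀ a : ℝ, ((2 * Real.cos a - 2 : ℝ) : ℂ) =
      (Complex.exp (a * Complex.I) - 1) ^ 2 / Complex.exp (a * Complex.I) := by
    intro a
    have h := Complex.exp_ne_zero (a * Complex.I)
    rw [Complex.ofReal_sub, Complex.ofReal_mul, Complex.ofReal_cos, Complex.ofReal_ofNat,
      Complex.two_cos, neg_mul, Complex.exp_neg]
    field_simp
    ring
  have e1 : (2 * Real.pi * ((i : ℂ) - 1 + k) * Complex.I / n) =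
      ((2 * Real.pi * ((i : ℝ) - 1 + k) / n : ℝ) : ℂ) * Complex.I := by
    push_cast; ring
  have e2 : (2 * Real.pi * ((i : ℂ) - 1) * Complex.I / n) =
      ((2 * Real.pi * ((i : ℝ) - 1) / n : ℝ) : ℂ) * Complex.I := by
    push_cast; ring
  have e3 : (2 * Real.pi * (2 * ((i : ℂ) - 1) + k) * Complex.I / n) =
      ((2 * Real.pi * ((i : ℝ) - 1 + k) / n : ℝ) : ℂ) * Complex.I +
      ((2 * Real.pi * ((i : ℝ) - 1) / n : ℝ) : ℂ) * Complex.I := by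
    push_cast; ring
  rw [modeEigenvalue, modeFactor, e1, e2, e3, Complex.exp_add, Complex.ofReal_mul,
    Complex.ofReal_mul (2 * Real.cos (2 * Real.pi * ((i : ℝ) - 1 + k) / n) - 2), key, key,
    Complex.ofReal_mul, Complex.ofReal_ofNat]
  have := Complex.exp_ne_zero (((2 * Real.pi * ((i : ℝ) - 1 + k) / n : ℝ) : ℂ) * Complex.I)
  have := Complex.exp_ne_zero (((2 * Real.pi * ((i : ℝ) - 1) / n : ℝ) : ℂ) * Complex.I)
  field_simp

theorem exp_sub_one_ne_zero {n : ℕ} [NeZero n] {j : ℤ} (hj : (j : ZMod n) ≠ 0) :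
    Complex.exp (2 * Real.pi * j * Complex.I / n) - 1 ≠ 0 := by
  have h : Complex.exp (2 * Real.pi * j * Complex.I / n) = stdAddChar (j : ZMod n) := by
    rw [stdAddChar_coe]
    congr 1
    ring
  rw [h, sub_ne_zero, ← AddChar.map_zero_eq_one (stdAddChar (N := n))]
  exact fun he => hj (injective_stdAddChar he)

/-- The case `k = 1` concerns the planar modes other than `0` and `-1`, the case `k = 0` the
nonconstant height modes. -/
theorem EigenvalueCondition.modeRate_le {n N : ℕ} [NeZero n] {κ : ℕ → ℝ} {α₀ : ℝ}
    (h : EigenvalueCondition n N κ α₀) (k : ℤ) (hk : k = 0 ∨ k = 1) (q : ZMod n) (hq : q ≠ 0)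
    (hqk : q + k ≠ 0) :
    ∃ c : ℝ, 0 < c ∧ ∀ α : ℕ → ℝ,
    (∀ m ∈ Finset.Icc 1 N, α m ∈ Set.Icc (m * Real.pi / n - α₀) (m * Real.pi / n + α₀)) →
      modeRate n N κ (fun m => k * α m) q ≤ -c := by
  obtain ⟨c, hc, h⟩ := h
  refine ⟨c / 16, by positivity, fun α hα => ?_⟩
  have hfac : modeFactor n (q.val + 1) k ≠ 0 := by
    have h1 := exp_sub_one_ne_zero (n := n) (j := q.val + k) (by
      push_cast; rwa [ZMod.natCast_zmod_val])
    have h2 := exp_sub_one_ne_zero (n := n) (j := q.val) (by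
      push_cast; rwa [ZMod.natCast_zmod_val])
    rw [modeFactor]
    push_cast at h1 h2 ⊢
    rw [add_sub_cancel_right]
    exact mul_ne_zero h1 h2
  have hlt := ZMod.val_lt q
  have := h α hα (q.val + 1) (by simp; omega) k (by rcases hk with rfl | rfl <;> simp) hfac
  -- `D` is the factor common to all `m`.
  set D := (2 * Real.cos (2 * Real.pi * (((q.val + 1 : ℕ) : ℝ) - 1 + k) / n) - 2) *
      (2 * Real.cos (2 * Real.pi * (((q.val + 1 : ℕ) : ℝ) - 1) / n) - 2) with hD
  have hsum : ∑ m ∈ Finset.Icc 1 N, κ m * (modeEigenvalue n m (q.val + 1) k (α m)).re =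
      -modeRate n N κ (fun m => k * α m) q * D := by
    rw [modeRate, ← Finset.sum_neg_distrib, Finset.sum_mul]
    refine Finset.sum_congr rfl fun m _ => ?_
    rw [modeEigenvalue_eq, Complex.ofReal_re, ← hD]
    push_cast
    rw [add_sub_cancel_right]
    ring
  rw [hsum] at this
  have b1 := Real.cos_le_one (2 * Real.pi * (((q.val + 1 : ℕ) : ℝ) - 1 + k) / n)
  have b2 := Real.neg_one_le_cos (2 * Real.pi * (((q.val + 1 : ℕ) : ℝ) - 1 + k) / n)
  have b3 := Real.cos_le_one (2 * Real.pi * (((q.val + 1 : ℕ) : ℝ) - 1) / n)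
  have b4 := Real.neg_one_le_cos (2 * Real.pi * (((q.val + 1 : ℕ) : ℝ) - 1) / n)
  have hD0 : 0 ≤ D := mul_nonneg_of_nonpos_of_nonpos (by linarith) (by linarith)
  have hD1 : D ≤ 16 := by rw [hD]; nlinarith
  have hD2 : 0 < D := hD0.lt_of_ne fun h0 => by
    rw [← h0, mul_zero] at this
    linarith
  by_contra! hcon
  nlinarith [mul_pos (show 0 < c / 16 + modeRate n N κ (fun m => k * α m) q by linarith) hD2]

/-! ### Regular polygons -/

theorem ext_planarPart {v w : EuclideanSpace ℝ (Fin 3)} (h : planarPart v = planarPart w)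
    (h2 : v 2 = w 2) : v = w := by
  rw [planarPart_apply, planarPart_apply] at h
  have hre := congrArg Complex.re h
  have him := congrArg Complex.im h
  simp at hre him
  ext j
  fin_cases j <;> assumption

theorem norm_sq_eq_planarPart (v : EuclideanSpace ℝ (Fin 3)) :
    ‖v‖ ^ 2 = ‖planarPart v‖ ^ 2 + v 2 ^ 2 := by
  rw [EuclideanSpace.norm_sq_eq, planarPart_apply, Complex.sq_norm, Complex.normSq_add_mul_I]
  simp [Fin.sum_univ_three]

theorem inner_eq_planarPart (v w : EuclideanSpace ℝ (Fin 3)) :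
    inner ℝ v w = ((starRingEnd ℂ) (planarPart v) * planarPart w).re + v 2 * w 2 := by
  rw [planarPart_apply, planarPart_apply]
  simp [PiLp.inner_apply, Fin.sum_univ_three]
  ring

/-- The regular polygon with centre `c` in the `xy`-plane, height `h` and complex amplitude `a`: vertex
`i` is `c + a e^{-2πji/n}`. The vertices run clockwise, as the definition of `formationSubspace` asks. -/
noncomputable def regularPolygon (n : ℕ) [NeZero n] (c : ℂ) (h : ℝ) (a : ℂ) : Config n :=
  WithLp.toLp 2 fun i => !₂[(c + a * stdAddChar (-i)).re, (c + a * stdAddChar (-i)).im, h]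

section
variable {n : ℕ} [NeZero n]

@[simp]
theorem planarPart_regularPolygon (c : ℂ) (h : ℝ) (a : ℂ) (i : ZMod n) :
    planarPart (regularPolygon n c h a i) = c + a * stdAddChar (-i) := by
  rw [planarPart_apply]
  simp only [regularPolygon]
  exact Complex.re_add_im _

@[simp]
theorem regularPolygon_apply_two (c : ℂ) (h : ℝ) (a : ℂ) (i : ZMod n) :
    regularPolygon n c h a i 2 = h := rfl

/-- The ratio of side length to circumradius in a regular `n`-gon. -/
noncomputable def chordFactor (n : ℕ) [NeZero n] : ℝ := ‖(stdAddChar (-1 : ZMod n) : ℂ) - 1‖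

theorem chordFactor_pos (hn : 3 ≤ n) : 0 < chordFactor n := by
  have : Fact (1 < n) := ⟨by omega⟩
  rw [chordFactor, norm_pos_iff, sub_ne_zero, ← AddChar.map_zero_eq_one (stdAddChar (N := n))]
  exact fun h => neg_ne_zero.2 one_ne_zero (injective_stdAddChar h)

theorem norm_stdAddChar (i : ZMod n) : ‖(stdAddChar i : ℂ)‖ = 1 := by
  rw [stdAddChar_apply]
  exact Circle.norm_coe _

theorem norm_side_regularPolygon (c : ℂ) (h : ℝ) (a : ℂ) (i : ZMod n) :
    ‖regularPolygon n c h a (i + 1) - regularPolygon n c h a i‖ = ‖a‖ * chordFactor n := by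
  rw [← sq_eq_sq₀ (norm_nonneg _) (by unfold chordFactor; positivity), norm_sq_eq_planarPart,
    map_sub, planarPart_regularPolygon, planarPart_regularPolygon, PiLp.sub_apply,
    regularPolygon_apply_two, regularPolygon_apply_two, neg_add, AddChar.map_add_eq_mul]
  have : c + a * (stdAddChar (-i) * stdAddChar (-1 : ZMod n)) - (c + a * stdAddChar (-i)) =
      a * stdAddChar (-i) * ((stdAddChar (-1 : ZMod n) : ℂ) - 1) := by ring
  rw [this, norm_mul, norm_mul, norm_stdAddChar, chordFactor]
  ring

theorem exp_mul_stdAddChar_neg_one :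
    Complex.exp ((2 * Real.pi / n : ℝ) * Complex.I) * stdAddChar (-1 : ZMod n) = 1 := by
  have h := stdAddChar_coe (N := n) (-1)
  push_cast at h
  rw [h, ← Complex.exp_add, Complex.exp_eq_one_iff]
  exact ⟨0, by push_cast; ring⟩

theorem regularPolygon_mem (c : ℂ) (h : ℝ) (a : ℂ) :
    regularPolygon n c h a ∈ formationSubspace n := by
  refine ⟨fun i _ _ => ext_planarPart ?_ ?_, by simp⟩
  · have e : (i : ZMod n) + 2 = i + 1 + 1 := by ring
    rw [planarPart_rot, e]
    simp only [map_sub, planarPart_regularPolygon, neg_add, AddChar.map_add_eq_mul]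
    linear_combination (-a * stdAddChar (-(i : ZMod n)) * (stdAddChar (-1 : ZMod n) - 1)) *
      exp_mul_stdAddChar_neg_one (n := n)
  · rw [rot_apply_two]
    simp

/-- The side vectors form a geometric progression with ratio `e^{-2πj/n}` in the plane and a constant
one in height; the in-plane constraint makes the constant zero. -/
theorem eq_regularPolygon_of_mem (hn : 3 ≤ n) {x : Config n} (hx : x ∈ formationSubspace n) :
    ∃ c h a, x = regularPolygon n c h a := by
  obtain ⟨hrot, hflat⟩ := hx
  set ζ : ℂ := stdAddChar (-1 : ZMod n) with hζ
  have hζ1 : ζ - 1 ≠ 0 := by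
    have := chordFactor_pos hn
    rwa [chordFactor, norm_pos_iff] at this
  have hdiff : ∀ j : ℕ, j + 2 ≤ n →
      planarPart (x ((j + 1 : ℕ) + 1) - x (j + 1 : ℕ)) =
        ζ ^ j * planarPart (x ((1 : ℕ) + 1) - x (1 : ℕ)) ∧
      (x ((j + 1 : ℕ) + 1) - x (j + 1 : ℕ)) 2 = (x ((1 : ℕ) + 1) - x (1 : ℕ)) 2 := by
    intro j
    induction j with
    | zero => intro _; simp
    | succ j ih =>
      intro hj
      obtain ⟨h1, h2⟩ := ih (by omega)
      have hr := hrot (j + 1) (by omega) (by omega)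
      have e : ((j + 1 : ℕ) : ZMod n) + 2 = ((j + 1 + 1 : ℕ) : ZMod n) + 1 := by push_cast; ring
      have e' : ((j + 1 : ℕ) : ZMod n) + 1 = ((j + 1 + 1 : ℕ) : ZMod n) := by push_cast; ring
      rw [e, e'] at hr
      rw [e', hr] at h1 h2
      rw [planarPart_rot] at h1
      rw [rot_apply_two] at h2
      refine ⟨?_, h2⟩
      rw [pow_succ]
      linear_combination ζ * h1 - planarPart (x (((j + 1 + 1 : ℕ) : ZMod n) + 1) -
        x ((j + 1 + 1 : ℕ) : ZMod n)) * exp_mul_stdAddChar_neg_one (n := n)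
  set d := planarPart (x ((1 : ℕ) + 1) - x (1 : ℕ))
  set e := (x ((1 : ℕ) + 1) - x (1 : ℕ)) 2 with he
  have hpos : ∀ j : ℕ, j < n → planarPart (x (j + 1 : ℕ)) =
      planarPart (x (1 : ℕ)) + d * ((ζ ^ j - 1) / (ζ - 1)) ∧
      x (j + 1 : ℕ) 2 = x (1 : ℕ) 2 + j * e := by
    intro j
    induction j with
    | zero => intro _; simp
    | succ j ih =>
      intro hj
      obtain ⟨h1, h2⟩ := ih (by omega)
      obtain ⟨h3, h4⟩ := hdiff j (by omega)
      have e' : ((j + 1 : ℕ) : ZMod n) + 1 = ((j + 1 + 1 : ℕ) : ZMod n) := by push_cast; ring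
      rw [e', map_sub, h1] at h3
      rw [e', PiLp.sub_apply, h2] at h4
      constructor
      · rw [eq_add_of_sub_eq h3, pow_succ]
        field_simp
        ring
      · rw [eq_add_of_sub_eq h4]
        push_cast
        ring
  -- The `n - 1` equal height steps and the last one, equal to them too, add up to zero.
  have hflat0 : e = 0 := by
    obtain ⟨j, rfl⟩ : ∃ j, n = j + 2 := ⟨n - 2, by omega⟩
    have h1 := (hpos (j + 1) (by omega)).2
    have h2 := (hpos j (by omega)).2
    have e1 : ((j + 2 : ℕ) : ZMod (j + 2)) - 1 = ((j + 1 : ℕ) : ZMod (j + 2)) := by push_cast; ring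
    rw [e1, h2, h1, Nat.cast_one] at hflat
    push_cast at hflat
    have : ((j : ℝ) + 2) * e = 0 := by linarith
    exact (mul_eq_zero.1 this).resolve_left (by positivity)
  refine ⟨planarPart (x (1 : ℕ)) - d / (ζ - 1), x (1 : ℕ) 2, d / (ζ - 1) * ζ⁻¹, ?_⟩
  ext1 i
  obtain ⟨j, hj, rfl⟩ : ∃ j : ℕ, j < n ∧ ((j + 1 : ℕ) : ZMod n) = i :=
    ⟨(i - 1).val, ZMod.val_lt _, by push_cast; rw [ZMod.natCast_zmod_val]; ring⟩
  obtain ⟨h1, h2⟩ := hpos j hj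
  have hζ0 : ζ ≠ 0 := by
    rw [← norm_pos_iff, hζ, norm_stdAddChar]
    exact one_pos
  have hpow : (stdAddChar (-((j + 1 : ℕ) : ZMod n)) : ℂ) = ζ ^ (j + 1) := by
    rw [hζ, ← AddChar.map_nsmul_eq_pow]
    simp
  refine ext_planarPart ?_ ?_
  · rw [h1, planarPart_regularPolygon, hpow, pow_succ]
    field_simp
    ring
  · rw [h2, regularPolygon_apply_two, hflat0]
    ring

/-- The coefficient of the mode `-1` of a regular polygon is `n` times its amplitude. -/
theorem dft_planar_regularPolygon (hn : 3 ≤ n) (c : ℂ) (h : ℝ) (a : ℂ) :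
    𝓕 (planar (regularPolygon n c h a)) (-1) = n * a := by
  have : Fact (1 < n) := ⟨by omega⟩
  have hsum : ∑ i : ZMod n, (stdAddChar i : ℂ) = 0 := by
    rw [AddChar.sum_eq_zero_iff_ne_zero]
    intro h0
    have := injective_stdAddChar (N := n) (a₁ := 1) (a₂ := 0) (by rw [h0]; simp)
    exact one_ne_zero this
  have hterm : ∀ i : ZMod n, stdAddChar (-(i * -1)) • planar (regularPolygon n c h a) i =
      stdAddChar i * c + a := fun i => by
    have : (stdAddChar i : ℂ) * stdAddChar (-i) = 1 := by
      rw [← AddChar.map_add_eq_mul, add_neg_cancel, AddChar.map_zero_eq_one]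
    rw [planar, planarPart_regularPolygon, mul_neg, mul_one, neg_neg, smul_eq_mul]
    linear_combination a * this
  rw [dft_apply, Finset.sum_congr rfl fun i _ => hterm i, Finset.sum_add_distrib,
    ← Finset.sum_mul, hsum]
  simp

/-- If the mode `-1` of `x` vanishes, then testing `x - P ⊥ M_n` against the polygon with the amplitude
`a` of the projection `P` gives `n |a|² = 0`, so `P` is a single point. -/
theorem dft_planar_ne_zero (hn : 3 ≤ n) {x : Config n}
    (hx : ∃ i j : ZMod n, (formationSubspace n).starProjection x i ≠
      (formationSubspace n).starProjection x j) : 𝓕 (planar x) (-1) ≠ 0 := by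
  intro h0
  obtain ⟨i, j, hij⟩ := hx
  obtain ⟨c, h, a, hP⟩ := eq_regularPolygon_of_mem hn
    ((formationSubspace n).starProjection_apply_mem x)
  have horth := (formationSubspace n).starProjection_inner_eq_zero x _
    (regularPolygon_mem (n := n) 0 0 a)
  have hterm : ∀ i : ZMod n, inner ℝ ((x - regularPolygon n c h a) i) (regularPolygon n 0 0 a i) =
      ((starRingEnd ℂ) a * (stdAddChar (-(i * -1)) • planar x i -
        stdAddChar (-(i * -1)) • planar (regularPolygon n c h a) i)).re := fun i => by
    have : (starRingEnd ℂ) (stdAddChar (-i) : ℂ) = stdAddChar i := by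
      rw [← AddChar.map_neg_eq_conj, neg_neg]
    rw [real_inner_comm, inner_eq_planarPart, planarPart_regularPolygon, regularPolygon_apply_two,
      zero_mul, add_zero, zero_add, map_mul, this, mul_neg, mul_one, neg_neg, PiLp.sub_apply,
      map_sub, planar, planar, smul_eq_mul, smul_eq_mul]
    ring_nf
  rw [hP, PiLp.inner_apply, Finset.sum_congr rfl fun i _ => hterm i, ← Complex.re_sum,
    ← Finset.mul_sum, Finset.sum_sub_distrib, ← dft_apply, ← dft_apply, h0,
    dft_planar_regularPolygon hn] at horth
  have ha : a = 0 := by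
    have e : (starRingEnd ℂ) a * (0 - n * a) = ((-(n * Complex.normSq a) : ℝ) : ℂ) := by
      push_cast
      rw [← Complex.mul_conj]
      ring
    rw [e, Complex.ofReal_re, neg_eq_zero] at horth
    simpa [NeZero.ne n] using horth
  refine hij (by rw [hP]; exact ext_planarPart (by simp [ha]) (by simp))

/-- What is left of a signal after removing its modes `0` and `-1`. These two are distinct because
`n ≥ 2`. -/
theorem sub_dft_modes (hn : 3 ≤ n) (w : ZMod n → ℂ) (i : ZMod n) :
    w i - (𝓕 w 0 / n + 𝓕 w (-1) / n * stdAddChar (-i)) =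
      (n : ℂ)⁻¹ * ∑ q ∈ (Finset.univ.erase 0).erase (-1), stdAddChar (q * i) * 𝓕 w q := by
  have : Fact (1 < n) := ⟨by omega⟩
  have h := invDFT_apply (𝓕 w) i
  rw [LinearEquiv.symm_apply_apply] at h
  rw [Finset.sum_erase_eq_sub (by simp), Finset.sum_erase_eq_sub (by simp), h]
  simp only [smul_eq_mul, zero_mul, AddChar.map_zero_eq_one, neg_mul, one_mul]
  ring

theorem sub_dft_zero (w : ZMod n → ℂ) (i : ZMod n) :
    w i - 𝓕 w 0 / n =
      (n : ℂ)⁻¹ * ∑ q ∈ Finset.univ.erase 0, stdAddChar (q * i) * 𝓕 w q := by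
  have h := invDFT_apply (𝓕 w) i
  rw [LinearEquiv.symm_apply_apply] at h
  rw [Finset.sum_erase_eq_sub (by simp), h]
  simp only [smul_eq_mul, zero_mul, AddChar.map_zero_eq_one, one_mul]
  ring

end

theorem tendsto_config_zero {n : ℕ} {ι : Type*} {l : Filter ι} {F : ι → Config n}
    (hp : ∀ i, Tendsto (fun t => planarPart (F t i)) l (𝓝 0))
    (hh : ∀ i, Tendsto (fun t => F t i 2) l (𝓝 0)) : Tendsto F l (𝓝 0) := by
  have h3 : ∀ i, Tendsto (fun t => F t i) l (𝓝 0) := fun i => by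
    refine ((PiLp.continuous_toLp 2 (fun _ : Fin 3 => ℝ)).tendsto 0).comp
      (f := fun t => (F t i).ofLp) (tendsto_pi_nhds.2 fun j => ?_)
    have hre := (Complex.continuous_re.tendsto _).comp (hp i)
    have him := (Complex.continuous_im.tendsto _).comp (hp i)
    simp only [Function.comp_def, planarPart_apply] at hre him
    fin_cases j
    · simpa using hre
    · simpa using him
    · exact hh i
  exact ((PiLp.continuous_toLp 2 (fun _ : ZMod n => EuclideanSpace ℝ (Fin 3))).tendsto 0).comp
      (f := fun t => (F t).ofLp) (tendsto_pi_nhds.2 h3)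

/-! ### The rate of the polygon mode -/

/-- The factor of `sin s` in the rate of the mode `-1` when all angles are shifted by `s`. -/
noncomputable def growthGain (n N : ℕ) (κ : ℕ → ℝ) : ℝ :=
  4 * ∑ m ∈ Finset.Icc 1 N, κ m * Real.sin (m * Real.pi / n)

/-- The mode `-1` grows for a small positive angle shift and shrinks for a small negative one: this is
how the common shift of the angles controls the size. -/
theorem modeRate_neg_one {n : ℕ} [NeZero n] (N : ℕ) (κ : ℕ → ℝ) (s : ℝ) :
    modeRate n N κ (fun m => m * Real.pi / n + s) (-1) = growthGain n N κ * Real.sin s := by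
  rw [modeRate, growthGain, Finset.mul_sum, Finset.sum_mul]
  refine Finset.sum_congr rfl fun m _ => ?_
  have hval : ((-1 : ZMod n).val : ℝ) = n - 1 := by
    obtain ⟨k, rfl⟩ : ∃ k, n = k + 1 := ⟨n - 1, by have := NeZero.pos n; omega⟩
    rw [ZMod.val_neg_one]
    push_cast
    ring
  have hn0 : (n : ℝ) ≠ 0 := NeZero.ne _
  have e : m * Real.pi / n + s + 2 * Real.pi * m * (-1 : ZMod n).val / n =
      s - m * Real.pi / n + m * (2 * Real.pi) := by
    rw [hval]
    field_simp
    ring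
  rw [e, Real.cos_add_nat_mul_two_pi, Real.cos_sub, Real.cos_add]
  ring

theorem sin_mul_pi_div_pos {n m : ℕ} (hm : 0 < m) (hmn : m < n) :
    0 < Real.sin (m * Real.pi / n) := by
  have h1 : (0 : ℝ) < m := by exact_mod_cast hm
  have h2 : (m : ℝ) < n := by exact_mod_cast hmn
  have h3 : (0 : ℝ) < n := h1.trans h2
  refine Real.sin_pos_of_pos_of_lt_pi (by positivity) ?_
  rw [div_lt_iff₀ h3]
  nlinarith [Real.pi_pos]

theorem growthGain_pos {n N : ℕ} (hN : 0 < N) (hNn : N < n - 1) {κ : ℕ → ℝ}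
    (hκ : ∀ m ∈ Finset.Icc 1 N, 0 < κ m) : 0 < growthGain n N κ := by
  refine mul_pos (by norm_num) (Finset.sum_pos (fun m hm => mul_pos (hκ m hm) ?_)
    ⟨1, by simp; omega⟩)
  rw [Finset.mem_Icc] at hm
  exact sin_mul_pi_div_pos (by omega) (by omega)

/-- For odd `n` the angle `mπ/n` misses `π/2` by at least `π/(2n)`. -/
theorem sin_mul_pi_div_le_of_odd {n m : ℕ} (hn : Odd n) (hmn : m ≤ n) :
    Real.sin (m * Real.pi / n) ≤ Real.cos (Real.pi / (2 * n)) := by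
  have hn0 : (0 : ℝ) < n := by exact_mod_cast hn.pos
  have hm : (m : ℝ) ≤ n := by exact_mod_cast hmn
  have hm0 : (0 : ℝ) ≤ m := m.cast_nonneg
  have hodd : (1 : ℝ) ≤ |(n : ℝ) - 2 * m| := by
    obtain ⟨j, rfl⟩ := hn
    have : (1 : ℤ) ≤ |((2 * j + 1 : ℕ) : ℤ) - 2 * m| := Int.one_le_abs (by omega)
    exact_mod_cast this
  have e : Real.pi / 2 - m * Real.pi / n = ((n : ℝ) - 2 * m) * (Real.pi / (2 * n)) := by
    field_simp
  have hpi := Real.pi_pos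
  have hq : 0 < Real.pi / (2 * n) := by positivity
  rw [← Real.cos_pi_div_two_sub, e, ← Real.cos_abs, abs_mul, abs_of_pos hq]
  refine Real.cos_le_cos_of_nonneg_of_le_pi hq.le ?_ (by nlinarith)
  have h1 : |(n : ℝ) - 2 * m| ≤ n := abs_le.2 ⟨by linarith, by linarith⟩
  calc |(n : ℝ) - 2 * m| * (Real.pi / (2 * n)) ≤ n * (Real.pi / (2 * n)) := by gcongr
    _ = Real.pi / 2 := by field_simp
    _ ≤ Real.pi := by linarith

theorem sqrt_two_mul_one_sub_cos {n : ℕ} (hn : 2 ≤ n) :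
    √(2 * (1 - Real.cos (2 * Real.pi / n))) = 2 * Real.sin (Real.pi / n) := by
  have h := sin_mul_pi_div_pos (n := n) (m := 1) one_pos (by omega)
  rw [Nat.cast_one, one_mul] at h
  have e : 2 * (1 - Real.cos (2 * Real.pi / n)) = (2 * Real.sin (Real.pi / n)) ^ 2 := by
    rw [mul_div_assoc, Real.cos_two_mul, Real.cos_sq']
    ring
  rw [e, Real.sqrt_sq (by positivity)]

/-- The constant `Γ` equals `2 ∑ κ m` for even `n` and `2 cos (π/(2n)) ∑ κ m` for odd `n`. -/
theorem growthGain_le_rateConst {n N : ℕ} (hn : 2 ≤ n) (hNn : N ≤ n) {κ : ℕ → ℝ}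
    (hκ : ∀ m ∈ Finset.Icc 1 N, 0 ≤ κ m) : growthGain n N κ ≤ rateConst n N κ := by
  have hpi := Real.pi_pos
  have hn0 : (0 : ℝ) < n := by exact_mod_cast (by omega : 0 < n)
  have hbound : ∀ b : ℝ, (∀ m ∈ Finset.Icc 1 N, Real.sin (m * Real.pi / n) ≤ b) →
      growthGain n N κ ≤ 2 * (2 * b * ∑ m ∈ Finset.Icc 1 N, κ m) := by
    intro b hb
    have : ∑ m ∈ Finset.Icc 1 N, κ m * Real.sin (m * Real.pi / n) ≤
        ∑ m ∈ Finset.Icc 1 N, κ m * b :=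
      Finset.sum_le_sum fun m hm => mul_le_mul_of_nonneg_left (hb m hm) (hκ m hm)
    rw [← Finset.sum_mul] at this
    rw [growthGain]
    linarith
  have hs := sin_mul_pi_div_pos (n := n) (m := 1) one_pos (by omega)
  rw [Nat.cast_one, one_mul] at hs
  rw [rateConst, gammaConst, sqrt_two_mul_one_sub_cos hn]
  split_ifs with hpar
  · rw [mul_div_cancel_right₀ _ hs.ne', ← mul_one (2 : ℝ)]
    simpa using hbound 1 fun m _ => Real.sin_le_one _
  · have h2 : Real.sin (Real.pi / n) =
        2 * Real.sin (Real.pi / (2 * n)) * Real.cos (Real.pi / (2 * n)) := by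
      rw [← Real.sin_two_mul]
      congr 1
      field_simp
    have h3 : 2 * Real.sin (Real.pi / (2 * n)) ≠ 0 := by
      intro h0
      rw [h2, h0, zero_mul] at hs
      exact lt_irrefl _ hs
    have e : 2 * Real.sin (Real.pi / n) / (2 * Real.sin (Real.pi / (2 * n))) =
        2 * Real.cos (Real.pi / (2 * n)) := by
      rw [h2, div_eq_iff h3]
      ring
    rw [e]
    refine hbound _ fun m hm => sin_mul_pi_div_le_of_odd (Nat.not_even_iff_odd.1 hpar) ?_
    rw [Finset.mem_Icc] at hm
    omega

/-- The rate of the mode `1` changes sign when all angles are shifted by `π`. If `α₀ ≥ π/2`, then the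
shifts `π/2` and `-π/2` are both allowed, and the rate cannot be negative at both. -/
theorem EigenvalueCondition.lt_pi_div_two {n N : ℕ} [NeZero n] {κ : ℕ → ℝ} {α₀ : ℝ} (hn : 3 ≤ n)
    (h : EigenvalueCondition n N κ α₀) : α₀ < Real.pi / 2 := by
  by_contra! hα
  have hpi := Real.pi_pos
  have : Fact (1 < n) := ⟨by omega⟩
  have h2 : (1 : ZMod n) + ((1 : ℤ) : ZMod n) ≠ 0 := by
    have : ((2 : ℕ) : ZMod n) ≠ 0 := by
      rw [Ne, ZMod.natCast_eq_zero_iff]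
      exact fun hd => by have := Nat.le_of_dvd two_pos hd; omega
    push_cast at this ⊢
    rwa [one_add_one_eq_two]
  obtain ⟨c, hc, hrate⟩ := h.modeRate_le 1 (Or.inr rfl) 1 one_ne_zero h2
  have hp := hrate (fun m => m * Real.pi / n + Real.pi / 2) fun m _ =>
    ⟨by linarith, by linarith⟩
  have hm := hrate (fun m => m * Real.pi / n - Real.pi / 2) fun m _ =>
    ⟨by linarith, by linarith⟩
  have hcos : ∀ a b : ℝ, Real.cos (a - Real.pi / 2 + b) = -Real.cos (a + Real.pi / 2 + b) := by
    intro a b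
    rw [← Real.cos_sub_pi]
    congr 1
    ring
  have hsum : modeRate n N κ (fun m => (1 : ℤ) * (m * Real.pi / n - Real.pi / 2)) 1 =
      -modeRate n N κ (fun m => (1 : ℤ) * (m * Real.pi / n + Real.pi / 2)) 1 := by
    rw [modeRate, modeRate, ← Finset.sum_neg_distrib]
    refine Finset.sum_congr rfl fun m _ => ?_
    have h0 := hcos (m * Real.pi / n) 0
    rw [add_zero, add_zero] at h0
    rw [Int.cast_one, one_mul, one_mul, hcos, h0]
    ring
  linarith

namespace IsSizeFunction

variable {f : ℝ → ℝ} {α₀ : ℝ}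

theorem sin_pos (hf : IsSizeFunction f) (h0 : 0 < α₀) (h1 : α₀ < Real.pi / 2) {p : ℝ}
    (hp : 0 < p) : 0 < Real.sin (α₀ * f p) := by
  have h2 := (mul_pos_iff_of_pos_left hp).1 (hf.mul_pos p hp.ne')
  have h3 := (abs_le.1 (hf.abs_le_one p)).2
  exact Real.sin_pos_of_pos_of_lt_pi (by positivity) (by nlinarith [Real.pi_pos])

theorem sin_neg (hf : IsSizeFunction f) (h0 : 0 < α₀) (h1 : α₀ < Real.pi / 2) {p : ℝ}
    (hp : p < 0) : Real.sin (α₀ * f p) < 0 := by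
  have h2 := hf.sin_pos h0 h1 (neg_pos.2 hp)
  rw [hf.odd, mul_neg, Real.sin_neg] at h2
  linarith

theorem mem_Icc (hf : IsSizeFunction f) (h0 : 0 ≤ α₀) (a p : ℝ) :
    a + α₀ * f p ∈ Set.Icc (a - α₀) (a + α₀) := by
  have h := abs_le.1 (hf.abs_le_one p)
  constructor <;> nlinarith

end IsSizeFunction

/-! ### Approach to regular polygons along a trajectory -/

namespace IsHybridTrajectory

variable {n N : ℕ} [NeZero n] {κ : ℕ → ℝ} {ρ α₀ τ : ℝ} {f : ℝ → ℝ} {x : ℝ → Config n}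

theorem planar_isPiecewiseCoupled (hx : IsHybridTrajectory n N κ ρ α₀ f τ x) :
    IsPiecewiseCoupled n N κ τ
      (fun k m => m * Real.pi / n + α₀ * f (avgDistError ρ (x (((k : ℝ) - 1) * τ))))
      (fun t => planar (x t)) where
  continuousOn i :=
    planarPart.toContinuousLinearMap.continuous.comp_continuousOn (hx.continuousOn i)
  hasDeriv k t ht i := by
    rw [← planarPart_cyclicControl]
    exact planarPart.toContinuousLinearMap.hasFDerivAt.comp_hasDerivWithinAt t
      (hx.hasDeriv k t ht i)

theorem height_isPiecewiseCoupled (hx : IsHybridTrajectory n N κ ρ α₀ f τ x) :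
    IsPiecewiseCoupled n N κ τ (fun _ _ => 0) (fun t => height (x t)) where
  continuousOn i := Complex.continuous_ofReal.comp_continuousOn
    ((EuclideanSpace.proj (𝕜 := ℝ) (2 : Fin 3)).continuous.comp_continuousOn (hx.continuousOn i))
  hasDeriv k t ht i := by
    rw [← height_cyclicControl κ (α₀ * f (avgDistError ρ (x (((k : ℝ) - 1) * τ))))]
    exact ((EuclideanSpace.proj (𝕜 := ℝ) (2 : Fin 3)).hasFDerivAt.comp_hasDerivWithinAt t
      (hx.hasDeriv k t ht i)).ofReal_comp

theorem tendsto_planar_mode_zero (hx : IsHybridTrajectory n N κ ρ α₀ f τ x) (hτ : 0 < τ)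
    (hα₀ : 0 < α₀) (hf : IsSizeFunction f) (heig : EigenvalueCondition n N κ α₀) {q : ZMod n}
    (hq : q ≠ 0) (hq1 : q ≠ -1) :
    Tendsto (fun t => 𝓕 (planar (x t)) q) atTop (𝓝 0) := by
  obtain ⟨c, hc, h⟩ := heig.modeRate_le 1 (Or.inr rfl) q hq
    (by rw [Int.cast_one]; exact fun h => hq1 (eq_neg_of_add_eq_zero_left h))
  refine hx.planar_isPiecewiseCoupled.tendsto_dft_zero hτ q hc fun k => ?_
  simpa using h (fun m => m * Real.pi / n + α₀ * f (avgDistError ρ (x (((k : ℝ) - 1) * τ))))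
    fun m _ => hf.mem_Icc hα₀.le _ _

theorem tendsto_height_mode_zero (hx : IsHybridTrajectory n N κ ρ α₀ f τ x) (hτ : 0 < τ)
    (hα₀ : 0 < α₀) (heig : EigenvalueCondition n N κ α₀) {q : ZMod n} (hq : q ≠ 0) :
    Tendsto (fun t => 𝓕 (height (x t)) q) atTop (𝓝 0) := by
  obtain ⟨c, hc, h⟩ := heig.modeRate_le 0 (Or.inl rfl) q hq (by simpa using hq)
  refine hx.height_isPiecewiseCoupled.tendsto_dft_zero hτ q hc fun k => ?_
  simpa using h (fun m => m * Real.pi / n) fun m _ => ⟨by linarith, by linarith⟩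

end IsHybridTrajectory

/-- The regular polygon made of the modes `0` and `-1` of the planar part and the mode `0` of the
heights; this is the orthogonal projection onto `M_n`. -/
noncomputable def nearestPolygon {n : ℕ} [NeZero n] (x : Config n) : Config n :=
  regularPolygon n (𝓕 (planar x) 0 / n) (𝓕 (height x) 0 / n).re (𝓕 (planar x) (-1) / n)

/-- The side length of `nearestPolygon x`. -/
noncomputable def sideLength {n : ℕ} [NeZero n] (x : Config n) : ℝ :=
  ‖𝓕 (planar x) (-1) / n‖ * chordFactor n

namespace IsHybridTrajectory

variable {n N : ℕ} [NeZero n] {κ : ℕ → ℝ} {ρ α₀ τ : ℝ} {f : ℝ → ℝ} {x : ℝ → Config n}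

theorem tendsto_sub_nearestPolygon (hx : IsHybridTrajectory n N κ ρ α₀ f τ x) (hn : 3 ≤ n)
    (hτ : 0 < τ) (hα₀ : 0 < α₀) (hf : IsSizeFunction f) (heig : EigenvalueCondition n N κ α₀) :
    Tendsto (fun t => x t - nearestPolygon (x t)) atTop (𝓝 0) := by
  refine tendsto_config_zero (fun i => ?_) fun i => ?_
  · have : ∀ t, planarPart ((x t - nearestPolygon (x t)) i) = (n : ℂ)⁻¹ *
        ∑ q ∈ (Finset.univ.erase 0).erase (-1), stdAddChar (q * i) * 𝓕 (planar (x t)) q := by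
      intro t
      rw [← sub_dft_modes hn, PiLp.sub_apply, map_sub, nearestPolygon, planarPart_regularPolygon]
      rfl
    simp only [this]
    have hsum : Tendsto (fun t => ∑ q ∈ (Finset.univ.erase (0 : ZMod n)).erase (-1),
        stdAddChar (q * i) * 𝓕 (planar (x t)) q) atTop
        (𝓝 (∑ q ∈ (Finset.univ.erase (0 : ZMod n)).erase (-1), stdAddChar (q * i) * 0)) := by
      refine tendsto_finsetSum _ fun q hq => Tendsto.const_mul _ ?_
      simp only [Finset.mem_erase, Finset.mem_univ, and_true] at hq
      exact hx.tendsto_planar_mode_zero hτ hα₀ hf heig hq.2 hq.1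
    simpa using hsum.const_mul (n : ℂ)⁻¹
  · have : ∀ t, (x t - nearestPolygon (x t)) i 2 = ((n : ℂ)⁻¹ *
        ∑ q ∈ Finset.univ.erase 0, stdAddChar (q * i) * 𝓕 (height (x t)) q).re := by
      intro t
      rw [← sub_dft_zero, PiLp.sub_apply, PiLp.sub_apply, nearestPolygon,
        regularPolygon_apply_two, Complex.sub_re]
      rfl
    simp only [this]
    have hsum : Tendsto (fun t => ∑ q ∈ Finset.univ.erase (0 : ZMod n),
        stdAddChar (q * i) * 𝓕 (height (x t)) q) atTop
        (𝓝 (∑ q ∈ Finset.univ.erase (0 : ZMod n), stdAddChar (q * i) * 0)) := by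
      refine tendsto_finsetSum _ fun q hq => Tendsto.const_mul _ ?_
      exact hx.tendsto_height_mode_zero hτ hα₀ heig (Finset.ne_of_mem_erase hq)
    have := (Complex.continuous_re.tendsto _).comp (hsum.const_mul (n : ℂ)⁻¹)
    simp only [mul_zero, Finset.sum_const_zero, Complex.zero_re] at this
    exact this

/-- Between sampling instants the side length is exactly exponential. -/
theorem sideLength_eq (hx : IsHybridTrajectory n N κ ρ α₀ f τ x) (hτ : 0 < τ) (k : ℕ) {t : ℝ}
    (ht : t ∈ Set.Icc ((k : ℝ) * τ) (((k : ℝ) + 1) * τ)) :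
    sideLength (x t) = Real.exp (growthGain n N κ *
      Real.sin (α₀ * f (avgDistError ρ (x (((k : ℝ) - 1) * τ)))) * (t - k * τ)) *
      sideLength (x (k * τ)) := by
  rw [sideLength, sideLength, hx.planar_isPiecewiseCoupled.dft_eq hτ (-1) k ht, modeRate_neg_one,
    mul_div_assoc, norm_mul, Complex.norm_exp, Complex.ofReal_re]
  ring

theorem sideLength_pos (hx : IsHybridTrajectory n N κ ρ α₀ f τ x) (hn : 3 ≤ n) (hτ : 0 < τ)
    (h0 : 𝓕 (planar (x 0)) (-1) ≠ 0) {t : ℝ} (ht : 0 ≤ t) : 0 < sideLength (x t) := by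
  have hgrid : ∀ k : ℕ, 0 < sideLength (x (k * τ)) := by
    intro k
    induction k with
    | zero =>
      rw [Nat.cast_zero, zero_mul, sideLength]
      exact mul_pos (norm_pos_iff.2 (div_ne_zero h0 (NeZero.ne _))) (chordFactor_pos hn)
    | succ k ih =>
      push_cast
      rw [hx.sideLength_eq hτ k (t := (k + 1) * τ) ⟨by nlinarith, le_rfl⟩]
      positivity
  rw [hx.sideLength_eq hτ ⌊t / τ⌋₊ (mem_Icc_floor_mul ht hτ)]
  have := hgrid ⌊t / τ⌋₊
  positivity

end IsHybridTrajectory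

theorem tendsto_avgDistError_sub {n : ℕ} [NeZero n] {ρ : ℝ} {x : ℝ → Config n}
    (h : Tendsto (fun t => x t - nearestPolygon (x t)) atTop (𝓝 0)) :
    Tendsto (fun t => avgDistError ρ (x t) - (1 - sideLength (x t) / ρ)) atTop (𝓝 0) := by
  have hn0 : (n : ℝ) ≠ 0 := NeZero.ne _
  have hside : ∀ i : ZMod n,
      Tendsto (fun t => sideLength (x t) - ‖x t (i + 1) - x t i‖) atTop (𝓝 0) := by
    intro i
    have hcoord : ∀ j : ZMod n, Tendsto (fun t => (x t - nearestPolygon (x t)) j) atTop (𝓝 0) :=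
      fun j => ((PiLp.continuous_apply 2 (fun _ : ZMod n => EuclideanSpace ℝ (Fin 3)) j).tendsto
        0).comp h
    have hdiff := ((hcoord (i + 1)).sub (hcoord i)).norm
    rw [sub_zero, norm_zero] at hdiff
    refine squeeze_zero_norm (fun t => ?_) hdiff
    rw [sideLength, ← norm_side_regularPolygon (𝓕 (planar (x t)) 0 / n)
      (𝓕 (height (x t)) 0 / n).re, Real.norm_eq_abs, abs_sub_comm]
    refine (abs_norm_sub_norm_le _ _).trans_eq ?_
    simp only [PiLp.sub_apply, nearestPolygon]
    congr 1
    abel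
  have hsum := ((tendsto_finsetSum Finset.univ fun i _ => hside i).div_const ρ).div_const (n : ℝ)
  simp only [Finset.sum_const_zero, zero_div] at hsum
  refine hsum.congr fun t => ?_
  rw [avgDistError]
  simp only [distError]
  rw [Finset.sum_sub_distrib, Finset.sum_sub_distrib, ← Finset.sum_div, Finset.sum_const,
    Finset.sum_const, Finset.card_univ, ZMod.card, nsmul_eq_mul, nsmul_eq_mul]
  field_simp
  ring

theorem avgDistError_le_one {n : ℕ} [NeZero n] {ρ : ℝ} (hρ : 0 < ρ) (x : Config n) :
    avgDistError ρ x ≤ 1 := by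
  have hn0 : (0 : ℝ) < n := by exact_mod_cast NeZero.pos n
  rw [avgDistError, div_le_one hn0]
  refine (Finset.sum_le_card_nsmul _ _ 1 fun i _ => ?_).trans_eq (by simp)
  rw [distError]
  have : 0 ≤ ‖x (i + 1) - x i‖ / ρ := by positivity
  linarith

/-- Compare `x` with the polygon of side `ρ` that has the centre and the phase of its
`nearestPolygon`. -/
theorem infDist_formationOfSize_le {n : ℕ} [NeZero n] {ρ : ℝ} (hρ : 0 < ρ) {x : Config n}
    (hx : 0 < sideLength x) : Metric.infDist x (formationOfSize n ρ) ≤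
      ‖x - nearestPolygon x‖ + ‖regularPolygon n 0 0
        ((1 - ρ / sideLength x : ℝ) * (𝓕 (planar x) (-1) / n))‖ := by
  set a := 𝓕 (planar x) (-1) / n with ha
  set y := regularPolygon n (𝓕 (planar x) 0 / n) (𝓕 (height x) 0 / n).re
    ((ρ / sideLength x : ℝ) * a) with hy
  have hmem : y ∈ formationOfSize n ρ := by
    refine ⟨regularPolygon_mem _ _ _, fun i => ?_⟩
    rw [hy, norm_side_regularPolygon, norm_mul, mul_assoc, Complex.norm_real, Real.norm_of_nonneg
      (by positivity)]
    exact div_mul_cancel₀ _ hx.ne'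
  have hsub : nearestPolygon x - y =
      regularPolygon n 0 0 ((1 - ρ / sideLength x : ℝ) * a) := by
    ext1 i
    refine ext_planarPart ?_ ?_
    · rw [PiLp.sub_apply, map_sub, hy, nearestPolygon]
      simp only [planarPart_regularPolygon]
      push_cast
      ring
    · rw [PiLp.sub_apply, PiLp.sub_apply, hy, nearestPolygon]
      simp
  refine (Metric.infDist_le_dist_of_mem hmem).trans ?_
  rw [dist_eq_norm, ← hsub]
  exact norm_sub_le_norm_sub_add_norm_sub _ _ _

/-! ### Convergence of the size -/

/-- The logarithm of the normalized side length at the sampling instants obeys the delayed recursion of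
`tendsto_zero_of_delayed_recursion`; between them it interpolates linearly. -/
theorem IsHybridTrajectory.tendsto_sideLength {n N : ℕ} [NeZero n] {κ : ℕ → ℝ} {ρ α₀ τ : ℝ}
    {f : ℝ → ℝ} {x : ℝ → Config n} (hx : IsHybridTrajectory n N κ ρ α₀ f τ x) (hn : 3 ≤ n)
    (hρ : 0 < ρ) (hτ : 0 < τ) (hα₀ : 0 < α₀) (hα₁ : α₀ < Real.pi / 2) (hf : IsSizeFunction f)
    (heig : EigenvalueCondition n N κ α₀) (hg : 0 < growthGain n N κ)
    (hlin : ∀ p, |p| < 1 → growthGain n N κ * τ * |Real.sin (α₀ * f p)| ≤ |p| / 8)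
    (h0 : 𝓕 (planar (x 0)) (-1) ≠ 0) :
    Tendsto (fun t => sideLength (x t)) atTop (𝓝 ρ) := by
  set g := growthGain n N κ
  set H : ℝ → ℝ := fun p => g * τ * Real.sin (α₀ * f p) with hH
  set p : ℕ → ℝ := fun k => avgDistError ρ (x (k * τ))
  set y : ℕ → ℝ := fun k => Real.log (sideLength (x (k * τ)) / ρ) with hy
  have hgτ : 0 < g * τ := mul_pos hg hτ
  have hHcont : Continuous H := by
    have := hf.continuous
    fun_prop
  have hpos : ∀ t, 0 ≤ t → 0 < sideLength (x t) / ρ := fun t ht =>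
    div_pos (hx.sideLength_pos hn hτ h0 ht) hρ
  have hlog : ∀ k : ℕ, ∀ t ∈ Set.Icc ((k : ℝ) * τ) (((k : ℝ) + 1) * τ),
      Real.log (sideLength (x t) / ρ) =
        g * Real.sin (α₀ * f (avgDistError ρ (x (((k : ℝ) - 1) * τ)))) * (t - k * τ) + y k := by
    intro k t ht
    rw [hx.sideLength_eq hτ k ht, mul_div_assoc, Real.log_mul (Real.exp_pos _).ne'
      (hpos _ (by positivity)).ne', Real.log_exp]
  have hstep : ∀ k : ℕ,
      y (k + 1) = y k + g * Real.sin (α₀ * f (avgDistError ρ (x (((k : ℝ) - 1) * τ)))) * τ := by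
    intro k
    have h := hlog k ((k + 1) * τ) ⟨by nlinarith, le_rfl⟩
    simp only [hy]
    push_cast
    rw [h]
    ring
  have hrec : ∀ k, y (k + 2) = y (k + 1) + H (p k) := by
    intro k
    rw [hstep (k + 1)]
    simp only [hH, p]
    push_cast
    rw [add_sub_cancel_right]
    ring
  have hkτ : Tendsto (fun k : ℕ => (k : ℝ) * τ) atTop atTop :=
    tendsto_natCast_atTop_atTop.atTop_mul_const hτ
  have hp : Tendsto (fun k => p k - (1 - Real.exp (y k))) atTop (𝓝 0) := by
    refine ((tendsto_avgDistError_sub (ρ := ρ)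
      (hx.tendsto_sub_nearestPolygon hn hτ hα₀ hf heig)).comp hkτ).congr fun k => ?_
    simp only [hy, Function.comp_apply]
    rw [Real.exp_log (hpos _ (by positivity))]
  -- The bound on `H` is assumed only for `|p| < 1`; it extends to the closed interval by continuity.
  have hHlin : ∀ p, |p| ≤ 1 → |H p| ≤ |p| / 8 := by
    have hclosed : IsClosed {p | |H p| ≤ |p| / 8} :=
      isClosed_le hHcont.abs (continuous_abs.div_const 8)
    have hsub : Set.Ioo (-1 : ℝ) 1 ⊆ {p | |H p| ≤ |p| / 8} := fun p hp => by
      rw [Set.mem_ofPred_eq, hH, abs_mul, abs_of_pos hgτ]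
      exact hlin p (abs_lt.2 hp)
    intro p hp
    have hmem : p ∈ closure (Set.Ioo (-1 : ℝ) 1) := by
      rw [closure_Ioo (by norm_num)]
      exact abs_le.1 hp
    exact hclosed.closure_subset_iff.2 hsub hmem
  have hylim : Tendsto y atTop (𝓝 0) :=
    tendsto_zero_of_delayed_recursion hHcont
      (fun p hp => mul_pos hgτ (hf.sin_pos hα₀ hα₁ hp))
      (fun p hp => mul_neg_of_pos_of_neg hgτ (hf.sin_neg hα₀ hα₁ hp)) hHlin
      (fun k => avgDistError_le_one hρ _) hp hrec
  have hloglim : Tendsto (fun t => Real.log (sideLength (x t) / ρ)) atTop (𝓝 0) := by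
    have hB : Tendsto (fun k => |y (k + 1) - y k| + |y k|) atTop (𝓝 0) := by
      simpa using (((tendsto_add_atTop_iff_nat 1).2 hylim).sub hylim).abs.add hylim.abs
    have hfloor : Tendsto (fun t : ℝ => ⌊t / τ⌋₊) atTop atTop :=
      tendsto_nat_floor_atTop.comp (tendsto_id.atTop_div_const hτ)
    refine squeeze_zero_norm' ?_ (hB.comp hfloor)
    filter_upwards [eventually_ge_atTop 0] with t ht
    obtain ⟨h1, h2⟩ := mem_Icc_floor_mul ht hτ
    simp only [Function.comp_apply]
    rw [hlog ⌊t / τ⌋₊ t ⟨h1, h2⟩, hstep ⌊t / τ⌋₊, Real.norm_eq_abs, add_sub_cancel_left]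
    refine (abs_add_le _ _).trans (add_le_add_left ?_ _)
    rw [abs_mul, abs_mul _ τ, abs_of_nonneg (sub_nonneg.2 h1), abs_of_pos hτ]
    gcongr
    linarith
  have hexp := ((Real.continuous_exp.tendsto 0).comp hloglim).const_mul ρ
  rw [Real.exp_zero, mul_one] at hexp
  refine hexp.congr' ?_
  filter_upwards [eventually_ge_atTop 0] with t ht
  rw [Function.comp_apply, Real.exp_log (hpos t ht)]
  field_simp

theorem tendsto_regularPolygon_zero {n : ℕ} [NeZero n] {a : ℝ → ℂ}
    (ha : Tendsto a atTop (𝓝 0)) : Tendsto (fun t => regularPolygon n 0 0 (a t)) atTop (𝓝 0) := by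
  refine tendsto_config_zero (fun i => ?_) fun i => by simp
  simp only [planarPart_regularPolygon, zero_add]
  simpa using ha.mul_const (stdAddChar (-i) : ℂ)

theorem theorem5 (n N : ℕ) [NeZero n] (hn : 3 ≤ n) (hN : 0 < N) (hNn : N < n - 1)
    (κ : ℕ → ℝ) (hκ : ∀ m ∈ Finset.Icc 1 N, 0 < κ m)
    (ρ α₀ τ T : ℝ) (hρ : 0 < ρ) (hα₀ : 0 < α₀) (hτ : 0 < τ) (hT : 0 < T)
    (f : ℝ → ℝ) (hf : IsSizeFunction f)
    (heig : EigenvalueCondition n N κ α₀)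
    (hTf : ∀ p : ℝ, |p| < 1 →
      1 / 2 * T * |p| ≤ |Real.sin (α₀ * f p)| ∧ |Real.sin (α₀ * f p)| ≤ T * |p|)
    (hτC : τ < min (1 / rateConst n N κ) (1 / (8 * rateConst n N κ * T)))
    (x : ℝ → Config n) (hx : IsHybridTrajectory n N κ ρ α₀ f τ x)
    -- the orthogonal projection of `x(0)` onto `M_n` is not a polygon shrunk to a point
    (hx0 : ∃ i j : ZMod n, (formationSubspace n).starProjection (x 0) i ≠
      (formationSubspace n).starProjection (x 0) j) :
    Filter.Tendsto (fun t : ℝ => Metric.infDist (x t) (formationOfSize n ρ))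
      Filter.atTop (nhds 0) := by
  have hg := growthGain_pos hN hNn hκ
  have hgC : growthGain n N κ ≤ rateConst n N κ :=
    growthGain_le_rateConst (by omega) (by omega) fun m hm => (hκ m hm).le
  have hα₁ := heig.lt_pi_div_two hn
  have h0 := dft_planar_ne_zero hn hx0
  have hgain : growthGain n N κ * τ * T ≤ 1 / 8 := by
    have h1 := (lt_min_iff.1 hτC).2
    rw [lt_div_iff₀ (by have := hg.trans_le hgC; positivity)] at h1
    have h2 : growthGain n N κ * (τ * T) ≤ rateConst n N κ * (τ * T) := by gcongr
    linarith
  have hside := hx.tendsto_sideLength hn hρ hτ hα₀ hα₁ hf heig hg (fun p hp => by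
    have h1 := mul_le_mul_of_nonneg_left (hTf p hp).2 (mul_pos hg hτ).le
    have h2 := mul_le_mul_of_nonneg_right hgain (abs_nonneg p)
    linarith) h0
  have hradius : Tendsto (fun t => ((1 - ρ / sideLength (x t) : ℝ) : ℂ) *
      (𝓕 (planar (x t)) (-1) / n)) atTop (𝓝 0) := by
    have hscale : Tendsto (fun t => 1 - ρ / sideLength (x t)) atTop (𝓝 0) := by
      simpa [hρ.ne'] using ((tendsto_const_nhds (x := ρ)).div hside hρ.ne').const_sub 1
    have hnorm : Tendsto (fun t => |1 - ρ / sideLength (x t)| *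
        (sideLength (x t) / chordFactor n)) atTop (𝓝 0) := by
      simpa using hscale.abs.mul (hside.div_const (chordFactor n))
    refine squeeze_zero_norm (fun t => le_of_eq ?_) hnorm
    rw [norm_mul, Complex.norm_real, Real.norm_eq_abs, sideLength,
      mul_div_cancel_right₀ _ (chordFactor_pos hn).ne']
  have hresize := tendsto_regularPolygon_zero (n := n) hradius
  have hbound := (hx.tendsto_sub_nearestPolygon hn hτ hα₀ hf heig).norm.add
    hresize.norm
  rw [norm_zero, add_zero] at hbound
  refine squeeze_zero' (Eventually.of_forall fun t => Metric.infDist_nonneg) ?_ hbound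
  filter_upwards [eventually_ge_atTop 0] with t ht
  exact infDist_formationOfSize_le hρ (hx.sideLength_pos hn hτ h0 ht)
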